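/- **Setup.** For $n\neq 0$ let $E=E_{n,\pi/3}:\ y^2=x(x-n)(x+3n)=x^3+Ax^2+Bx$ with $A=2n$, $B=-3n^2$, and let $E':\ y^2=x^3-2Ax^2+(A^2-4B)x$. For a field $K\supseteq\mathbb{Q}$ define $\delta'_K:E(K)\to K^*/{K^*}^2$ by $O\mapsto 1$, $(0,0)\mapsto B$, $(x,y)\mapsto x$ otherwise, and $\delta_K:E'(K)\to K^*/{K^*}^2$ by $O\mapsto 1$, $(0,0)\mapsto A^2-4B$, $(x,y)\mapsto x$ otherwise. Let $D\subseteq \mathbb{Q}^*/{\mathbb{Q}^*}^2$ be the subgroup generated by $-1$ and the primes dividing $B^2(A^2-4B)$. Let $S(E)$ (respectively $S'(E)$) be the set of $d\in D$ whose class lies in the image of $\delta_K$ (respectively $\delta'_K$) for $K=\mathbb{R}$ and for $K=\mathbb{Q}_p$ for every prime $p\mid B^2(A^2-4B)$. Integers below denote their classes in $\mathbb{Q}^*/{\mathbb{Q}^*}^2$. For a square-free integer $m\neq 1$, let $G(m)$ be the directed graph whose vertices are the prime divisors of $m$, together with $-1$ if $m<0$, with an arc $p\to v$ exactly when $p$ is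 a prime vertex with $p\equiv 1\pmod 3$ and $v$ is a vertex with $\left(\frac{v}{p}\right)=-1$. An (unordered) partition $\{V_1,\overline{V}_1\}$ of the vertex set $V$ is odd if some vertex in one part has an odd number of arcs into the other part; it is trivial if one part is empty. Put $d(V_1)=\prod_{v\in V_1}v$. **Theorem 4.1.** Let $n=p_1\cdots p_t$ $(t\ge 1)$ where the $p_i\ge 5$ are distinct primes, and $E=E_{n,\pi/3}$. (I) Let $n\equiv 1,7,19\pmod{24}$. (I.1) $S'(E)=\{1,n,-3n,-3\}$ if and only if (a) $p_i\equiv 1\pmod 3$ for all $i$, and (b) in $G(-3n)$ all partitions of $V=\{-1,3,p_1,\dots,p_t\}$ are odd except the trivial one and $\{\{-1,3\},\{p_1,\dots,p_t\}\}$. (I.2) Assume $p_i\equiv 1\pmod 3$ for all $i$. Then $S(E)=\{1\}$ if and only if in $G(-n)$, for all $V_1\subseteq\{p_1,\dots,p_t\}$ with $d(V_1)>1$ and $d(V_1)\equiv 1\pmod 4$, the partition $\{V_1,\overline{V}_1\}$ of $V=\{-1,p_1,\dots,p_t\}$ is odd. (II) Let $n\equiv 5\pmod{24}$. (II.1) $S'(E)=\{1,n,-3n,-3\}$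 if and only if (a) after reordering the $p_i$ we have $p_i\equiv 1\pmod 3$ for $1\le i\le t-1$ and $p_t\equiv 2\pmod 3$, and (b) in $G(-3n)$, for all $V_1\subseteq V=\{-1,3,p_1,\dots,p_t\}$ with $d(V_1)\equiv 1\pmod 4$, the partition $\{V_1,\overline{V}_1\}$ of $V$ is odd, except the trivial one and $\{\{-1,3\},\{p_1,\dots,p_t\}\}$. (II.2) Assume that (II.1)(a) holds, with the primes so ordered. Then $S(E)=\{1\}$ if and only if in $G(-n)$, for all non-empty $V_1\subseteq\{p_1,\dots,p_{t-1}\}$ with $\left(\frac{d(V_1)}{p_t}\right)=1$, the partition $\{V_1,\overline{V}_1\}$ of $V=\{-1,p_1,\dots,p_t\}$ is odd. -/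

import Mathlib

noncomputable section

namespace SelmerTwo

/-- The group `Kˣ / (Kˣ)²` of square classes of a field `K`. -/
abbrev SqClass (K : Type*) [Field K] : Type _ := Kˣ ⧸ Subgroup.square Kˣ

open Classical in
/-- The square class of a non-zero element of `K`. It is only ever used at non-zero elements;
the value at `0` is irrelevant. -/
def sqClass {K : Type*} [Field K] (z : K) : SqClass K :=
  if h : z = 0 then 1 else QuotientGroup.mk (Units.mk0 z h)

/-- The natural homomorphism `ℚˣ / (ℚˣ)² → Kˣ / (Kˣ)²` for a field `K` of characteristic zero. -/
def localize (K : Type*) [Field K] [CharZero K] : SqClass ℚ →* SqClass K :=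
  QuotientGroup.map _ _ (Units.map (algebraMap ℚ K : ℚ →* K)) (by
    intro u hu
    obtain ⟨r, rfl⟩ := (Subgroup.mem_square.mp hu)
    exact Subgroup.mem_square.mpr ⟨Units.map (algebraMap ℚ K : ℚ →* K) r, map_mul _ r r⟩)

/-- The Weierstrass curve `y² = x³ + A x² + B x` over the field `K`. -/
def curve (K : Type*) [Field K] (A B : ℤ) : WeierstrassCurve K where
  a₁ := 0
  a₂ := (A : K)
  a₃ := 0
  a₄ := (B : K)
  a₆ := 0

open Classical in
/-- For `C : y² = x³ + A x² + B x` over `K`, the map `C(K) → Kˣ / (Kˣ)²` that sends `O` to `1`,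
the point `(0, 0)` to the class of `B`, and any other point `(x, y)` to the class of `x`.
(A point with `x = 0` has `y = 0`.) -/
def descentMap (K : Type*) [Field K] (A B : ℤ) : (curve K A B).toAffine.Point → SqClass K
  | .zero => 1
  | .some x _ _ => if x = 0 then sqClass (B : K) else sqClass x

/-- The discriminant `B² (A² - 4 B)` attached to `E : y² = x³ + A x² + B x`. -/
def disc (A B : ℤ) : ℤ := B ^ 2 * (A ^ 2 - 4 * B)

/-- The subgroup `D(E)` of `ℚˣ / (ℚˣ)²` generated by `-1` and the primes that divide the
discriminant of `E : y² = x³ + A x² + B x`. -/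
def classGroupD (A B : ℤ) : Subgroup (SqClass ℚ) :=
  Subgroup.closure
    ({sqClass (-1 : ℚ)} ∪ {c | ∃ p : ℕ, p.Prime ∧ (p : ℤ) ∣ disc A B ∧ c = sqClass (p : ℚ)})

/-- The classes `d ∈ D(E)`, for `E : y² = x³ + A x² + B x`, whose image in `Kᵥˣ / (Kᵥˣ)²` comes
from a `Kᵥ`-point of the curve `y² = x³ + a x² + b x`, for `Kᵥ = ℝ` and for `Kᵥ = ℚ_p` with `p`
running through the primes dividing the discriminant of `E`. -/
def localConditions (A B a b : ℤ) : Set (SqClass ℚ) :=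
  {d | d ∈ classGroupD A B ∧
    localize ℝ d ∈ Set.range (descentMap ℝ a b) ∧
    ∀ (p : ℕ) [Fact p.Prime], (p : ℤ) ∣ disc A B →
      localize ℚ_[p] d ∈ Set.range (descentMap ℚ_[p] a b)}

/-- The Selmer group `S'(E)` of `E : y² = x³ + A x² + B x`: local conditions from the points of
`E` itself. -/
def selmer' (A B : ℤ) : Set (SqClass ℚ) := localConditions A B A B

/-- The Selmer group `S(E)` of `E : y² = x³ + A x² + B x`: local conditions from the points of the
2-isogenous curve `E' : y² = x³ - 2 A x² + (A² - 4 B) x`. -/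
def selmer (A B : ℤ) : Set (SqClass ℚ) := localConditions A B (-2 * A) (A ^ 2 - 4 * B)

/-- The coefficient `A = 2 n` of `y² = x (x - n) (x + 3 n)`. -/
def coeffA (n : ℤ) : ℤ := 2 * n

/-- The coefficient `B = -3 n²` of `y² = x (x - n) (x + 3 n)`. -/
def coeffB (n : ℤ) : ℤ := -3 * n ^ 2

theorem curve_equation_iff (K : Type*) [Field K] (n : ℤ) (x y : K) :
    (curve K (coeffA n) (coeffB n)).toAffine.Equation x y ↔ y ^ 2 = x * (x - n) * (x + 3 * n) := by
  rw [WeierstrassCurve.Affine.equation_iff]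
  simp only [curve, coeffA, coeffB]
  push_cast
  constructor <;> intro h <;> linear_combination h

/-- The vertex set of `G(m)` for a square-free integer `m`: the prime divisors of `m`, together
with `-1` if `m < 0`. -/
def graphVertices (m : ℤ) : Finset ℤ :=
  (if m < 0 then {-1} else ∅) ∪ m.natAbs.primeFactors.image (fun p : ℕ => (p : ℤ))

/-- The directed graph `G(m)`: there is an arc `p → v` between vertices of `G(m)` exactly if `p`
is a prime with `p ≡ 1 (mod 3)` and Legendre symbol `(v / p) = -1`. The ambient type is `ℤ`; all
arcs are between elements of `graphVertices m`. -/
def graphG (m : ℤ) : Digraph ℤ where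
  Adj u v := u ∈ graphVertices m ∧ v ∈ graphVertices m ∧
    ∃ (p : ℕ) (_ : Fact p.Prime), u = (p : ℤ) ∧ p ≡ 1 [MOD 3] ∧ legendreSym p v = -1

open Classical in
/-- The number of arcs of `G` from the vertex `v` into the set `W`. -/
def arcsInto {V : Type*} (G : Digraph V) (v : V) (W : Finset V) : ℕ :=
  (W.filter (fun w => G.Adj v w)).card

/-- A partition `{V₁, V₂}` of the vertices is odd if some vertex of one part has an odd number of
arcs into the other part. -/
def IsOddPartition {V : Type*} (G : Digraph V) (V₁ V₂ : Finset V) : Prop :=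
  (∃ v ∈ V₁, Odd (arcsInto G v V₂)) ∨ (∃ v ∈ V₂, Odd (arcsInto G v V₁))

/-- The partition of the vertex set of `G(m)` with parts `V₁` and its complement is odd. -/
def OddIn (m : ℤ) (V₁ : Finset ℤ) : Prop :=
  IsOddPartition (graphG m) V₁ (graphVertices m \ V₁)

/-- `d(V₁)`, the product of the elements of `V₁`. -/
def dProd (V₁ : Finset ℤ) : ℤ := ∏ v ∈ V₁, v

end SelmerTwo

end

/-! Every class in `D` is represented by `d(W)` for exactly one subset `W` of `{2, -1, 3} ∪ P`,
where `P` is the set of the `p_i`. Both Selmer sets are thus families of subsets `W`, cut out by the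
local images of the descent maps.

For `E` the image is everything over `ℝ`, over `ℚ_3`, and over `ℚ_q` for `q ∣ n` with `q ≡ 2 (mod
3)`. It is `{1, -3n}` for `q ∣ n` with `q ≡ 1 (mod 3)`. At `2` it requires `d` odd, and `d ≡ 1 (mod
4)` if `n ≡ 5 (mod 8)`. For `E'` the image is the positive classes over `ℝ`, trivial over `ℚ_3` and
at `q ≡ 2 (mod 3)`, and `{1, -n}` at `q ≡ 1 (mod 3)`. At `2` it requires `d` odd, and `d ≡ 1 (mod
4)` unless `n ≡ 5 (mod 8)`. The dichotomy mod 3 arises because `-3` is a square in `ℚ_q` exactly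
when `q ≡ 1 (mod 3)` (`isSquare_neg_three_iff`).

The products of the vertices of `G(-3n)` and `G(-n)` are `-3n` and `-n`. So the condition at `q ≡ 1
(mod 3)` always reads `d(W) ∈ {1, d(V)}` modulo `q`-adic squares. By multiplicativity of the
Legendre symbol, it says that `q` has an even number of arcs to the part not containing it
(`not_oddIn_iff`). Hence the Selmer classes are the even partitions subject to some congruences
(`mem_selmer'_iff`, `mem_selmer_iff`).

It remains to see that a minimal `S'(E)` forces (a). If `r` of the primes are `1 mod 3`, the even
subsets of the `t + 2` vertices with `d(W) ≡ 1 (mod 4)` form an `𝔽₂`-space cut out by `r + 1` linear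
conditions. If it has at most four elements then `r ≥ t - 1` (`eq_of_not_modEq`), and `n mod 3`
decides between `r = t` and `r = t - 1`. -/

namespace SelmerTwo

/-! ### Squares in `ℚ_p` -/

theorem isSquare_one_add_of_norm_lt {p : ℕ} [Fact p.Prime] {t : ℚ_[p]}
    (ht : ‖t‖ < ‖(2 : ℚ_[p])‖ ^ 2) : IsSquare (1 + t) := by
  have h2 : ‖(2 : ℚ_[p])‖ ≤ 1 := by exact_mod_cast Padic.norm_int_le_one (p := p) 2
  have ht1 : ‖t‖ ≤ 1 := ht.le.trans (pow_le_one₀ (norm_nonneg _) h2)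
  let s : ℤ_[p] := ⟨t, ht1⟩
  let F : Polynomial ℤ_[p] := Polynomial.X ^ 2 - Polynomial.C (1 + s)
  -- Hensel at the approximate root `1`: the value is `-t` and the derivative `2`, so the bound `‖2‖
  -- ^ 2` also covers `p = 2`.
  have hF : ‖F.aeval (1 : ℤ_[p])‖ < ‖F.derivative.aeval (1 : ℤ_[p])‖ ^ 2 := by
    have h1 : F.aeval (1 : ℤ_[p]) = -s := by simp [F]
    have h3 : F.derivative.aeval (1 : ℤ_[p]) = 2 := by simp [F, one_add_one_eq_two]
    rw [h1, h3, norm_neg]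
    exact ht
  obtain ⟨z, hz, -⟩ := hensels_lemma hF
  have hz' : z ^ 2 = 1 + s := by
    have : z ^ 2 - (1 + s) = 0 := by simpa [F] using hz
    exact sub_eq_zero.mp this
  refine ⟨(z : ℚ_[p]), ?_⟩
  have := congrArg (fun w : ℤ_[p] => (w : ℚ_[p])) hz'
  simp only [PadicInt.coe_pow, PadicInt.coe_add, PadicInt.coe_one] at this
  rw [← sq, this]

theorem norm_two_of_ne_two {p : ℕ} [hp : Fact p.Prime] (h2 : p ≠ 2) : ‖(2 : ℚ_[p])‖ = 1 := by
  have := (Padic.norm_natCast_eq_one_iff (p := p) (n := 2)).mpr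
    ((Nat.coprime_primes hp.out Nat.prime_two).mpr h2)
  exact_mod_cast this

theorem isSquare_one_add {p : ℕ} [Fact p.Prime] (h2 : p ≠ 2) {t : ℚ_[p]} (ht : ‖t‖ < 1) :
    IsSquare (1 + t) :=
  isSquare_one_add_of_norm_lt (by rwa [norm_two_of_ne_two h2, one_pow])

theorem isSquare_mul_left_iff {K : Type*} [Field K] {a b : K} (ha : IsSquare a) (h0 : a ≠ 0) :
    IsSquare (a * b) ↔ IsSquare b := by
  refine ⟨fun h => ?_, fun h => ha.mul h⟩
  have := h.div ha
  rwa [mul_div_cancel_left₀ _ h0] at this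

theorem isSquare_mul_right_iff {K : Type*} [Field K] {a b : K} (ha : IsSquare a) (h0 : a ≠ 0) :
    IsSquare (b * a) ↔ IsSquare b := by
  rw [mul_comm, isSquare_mul_left_iff ha h0]

/-- Being in the same square class, expressed by `IsSquare (a * b)`, is transitive. -/
theorem isSquare_mul_trans {K : Type*} [Field K] {a b c : K} (hb : b ≠ 0)
    (h₁ : IsSquare (a * b)) (h₂ : IsSquare (b * c)) : IsSquare (a * c) := by
  have h := h₁.mul h₂
  have e : a * b * (b * c) = b * b * (a * c) := by ring
  rw [e] at h
  exact (isSquare_mul_left_iff ⟨b, rfl⟩ (mul_ne_zero hb hb)).mp h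

theorem isSquare_of_norm_sub_lt {p : ℕ} [Fact p.Prime] (h2 : p ≠ 2) {a b : ℚ_[p]}
    (h : ‖a - b‖ < ‖b‖) : IsSquare (a * b) := by
  have hb : b ≠ 0 := by
    rintro rfl
    simp at h
    exact absurd h (not_lt.mpr (norm_nonneg _))
  have hb' : 0 < ‖b‖ := norm_pos_iff.mpr hb
  have h1 : IsSquare (1 + (a - b) / b) :=
    isSquare_one_add h2 (by rw [norm_div]; exact (div_lt_one hb').mpr h)
  have e : a * b = b * b * (1 + (a - b) / b) := by field_simp; ring
  rw [e]
  exact IsSquare.mul ⟨b, rfl⟩ h1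

theorem toZMod_eq_zero_iff {p : ℕ} [Fact p.Prime] (w : ℤ_[p]) :
    PadicInt.toZMod w = 0 ↔ ‖w‖ < 1 := by
  rw [← RingHom.mem_ker, PadicInt.ker_toZMod, IsLocalRing.mem_maximalIdeal, PadicInt.mem_nonunits]

theorem isSquare_coe_iff {p : ℕ} [Fact p.Prime] (h2 : p ≠ 2) {w : ℤ_[p]} (hw : ‖w‖ = 1) :
    IsSquare (w : ℚ_[p]) ↔ IsSquare (PadicInt.toZMod w) := by
  constructor
  · rintro ⟨z, hz⟩
    have hz1 : ‖z‖ ≤ 1 := by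
      have : ‖z‖ * ‖z‖ = 1 := by rw [← norm_mul, ← hz]; exact hw
      nlinarith [norm_nonneg z]
    let z' : ℤ_[p] := ⟨z, hz1⟩
    have : w = z' * z' := PadicInt.ext hz
    rw [this, map_mul]
    exact ⟨_, rfl⟩
  · rintro ⟨z, hz⟩
    obtain ⟨v, rfl⟩ : ∃ v : ℤ_[p], PadicInt.toZMod v = z := ZMod.ringHom_surjective _ z
    have h0 : PadicInt.toZMod w ≠ 0 := by
      rw [Ne, toZMod_eq_zero_iff, hw]; exact lt_irrefl _
    have hv : ‖v‖ = 1 := by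
      refine le_antisymm (PadicInt.norm_le_one v) (not_lt.mp fun h => h0 ?_)
      rw [hz, (toZMod_eq_zero_iff v).mpr h, mul_zero]
    have hlt : ‖w - v * v‖ < 1 := by
      rw [← toZMod_eq_zero_iff, map_sub, map_mul, hz, sub_self]
    have h1 : IsSquare ((w : ℚ_[p]) * ((v * v : ℤ_[p]) : ℚ_[p])) := by
      apply isSquare_of_norm_sub_lt h2
      rw [← PadicInt.coe_sub]
      have : ‖((v * v : ℤ_[p]) : ℚ_[p])‖ = 1 := by
        rw [PadicInt.padic_norm_e_of_padicInt, norm_mul, hv, one_mul]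
      rw [this]
      exact hlt
    refine (isSquare_mul_right_iff ⟨(v : ℚ_[p]), PadicInt.coe_mul v v⟩ ?_).mp h1
    rw [PadicInt.coe_ne_zero, ← norm_ne_zero_iff, norm_mul, hv]
    norm_num

theorem isSquare_intCast_iff {p : ℕ} [Fact p.Prime] (h2 : p ≠ 2) {a : ℤ} (ha : ¬ (p : ℤ) ∣ a) :
    IsSquare (a : ℚ_[p]) ↔ legendreSym p a = 1 := by
  have h0 : (a : ZMod p) ≠ 0 := by rwa [Ne, ZMod.intCast_zmod_eq_zero_iff_dvd]
  have hn : ‖(a : ℤ_[p])‖ = 1 :=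
    le_antisymm (PadicInt.norm_le_one _)
      (not_lt.mp fun h => ha ((PadicInt.norm_int_lt_one_iff_dvd a).mp h))
  rw [legendreSym.eq_one_iff p h0, ← PadicInt.coe_intCast, isSquare_coe_iff h2 hn, map_intCast]

/-- Every element of `ℚ_p` is, up to squares, a unit or a unit times a given uniformizer. -/
theorem exists_norm_eq_sq {p : ℕ} [hp : Fact p.Prime] {c d : ℚ_[p]} (hd : d ≠ 0)
    (hc : ‖c‖ = (p : ℝ)⁻¹) :
    ∃ z : ℚ_[p], z ≠ 0 ∧ (‖d‖ = ‖z‖ ^ 2 ∨ ‖d * c‖ = ‖z‖ ^ 2) := by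
  have hp0 : (p : ℚ_[p]) ≠ 0 := by exact_mod_cast hp.out.ne_zero
  have hpr : (p : ℝ) ≠ 0 := by exact_mod_cast hp.out.ne_zero
  rcases Int.even_or_odd' d.valuation with ⟨k, hk | hk⟩
  · refine ⟨(p : ℚ_[p]) ^ k, zpow_ne_zero _ hp0, Or.inl ?_⟩
    rw [Padic.norm_eq_zpow_neg_valuation hd, Padic.norm_p_zpow, hk, ← zpow_natCast, ← zpow_mul]
    congr 1
    push_cast
    ring
  · refine ⟨(p : ℚ_[p]) ^ (k + 1), zpow_ne_zero _ hp0, Or.inr ?_⟩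
    rw [norm_mul, hc, Padic.norm_eq_zpow_neg_valuation hd, Padic.norm_p_zpow, hk, ← zpow_natCast,
      ← zpow_mul, ← zpow_neg_one, ← zpow_add₀ hpr]
    congr 1
    push_cast
    ring

/-- Parity of valuations. This is the obstruction behind all the local non-existence results at odd
primes and the exclusion of even classes at `2`. -/
theorem norm_eq_inv_ne_sq {p : ℕ} [hp : Fact p.Prime] {c : ℚ_[p]} (hc : ‖c‖ = (p : ℝ)⁻¹)
    (z : ℚ_[p]) : ‖c‖ ≠ ‖z‖ ^ 2 := by
  intro h
  have hp1 : (1 : ℝ) < p := by exact_mod_cast hp.out.one_lt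
  rcases eq_or_ne z 0 with rfl | hz
  · rw [hc] at h
    have : (0 : ℝ) < (p : ℝ)⁻¹ := by positivity
    simp only [norm_zero, ne_eq, OfNat.ofNat_ne_zero, not_false_eq_true, zero_pow] at h
    linarith
  · rw [hc, Padic.norm_eq_zpow_neg_valuation hz, ← zpow_natCast, ← zpow_mul, ← zpow_neg_one] at h
    have := zpow_right_injective₀ (by linarith) hp1.ne' h
    push_cast at this
    omega

theorem not_isSquare_of_norm_eq_inv {p : ℕ} [hp : Fact p.Prime] {c : ℚ_[p]}
    (hc : ‖c‖ = (p : ℝ)⁻¹) : ¬ IsSquare c := by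
  rintro ⟨z, hz⟩
  refine norm_eq_inv_ne_sq hc z ?_
  rw [hz, norm_mul, sq]

theorem isSquare_unit_or_mul {p : ℕ} [Fact p.Prime] (h2 : p ≠ 2) {u d : ℚ_[p]}
    (hu : ‖u‖ = 1) (hns : ¬ IsSquare u) (hd : ‖d‖ = 1) : IsSquare d ∨ IsSquare (d * u) := by
  set u' : ℤ_[p] := ⟨u, hu.le⟩
  set d' : ℤ_[p] := ⟨d, hd.le⟩
  have eu : (u' : ℚ_[p]) = u := rfl
  have ed : (d' : ℚ_[p]) = d := rfl
  have hu' : ‖u'‖ = 1 := hu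
  have hd' : ‖d'‖ = 1 := hd
  have hud : ‖d' * u'‖ = 1 := by rw [norm_mul, hu', hd', one_mul]
  rw [← eu, isSquare_coe_iff h2 hu'] at hns
  rw [← eu, ← ed, ← PadicInt.coe_mul, isSquare_coe_iff h2 hd', isSquare_coe_iff h2 hud, map_mul]
  by_contra! hcon
  have h1 := (quadraticChar_neg_one_iff_not_isSquare).mpr hcon.1
  have h3 := (quadraticChar_neg_one_iff_not_isSquare).mpr hns
  have h4 := (quadraticChar_neg_one_iff_not_isSquare).mpr hcon.2
  rw [map_mul, h1, h3] at h4
  norm_num at h4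

/-- For odd `p` the group of square classes has order four, generated by a non-square unit and a
uniformizer. A local image containing such representatives is therefore everything. -/
theorem isSquare_mul_one_of_four {p : ℕ} [Fact p.Prime] (h2 : p ≠ 2) {u c d : ℚ_[p]}
    (hu : ‖u‖ = 1) (hns : ¬ IsSquare u) (hc : ‖c‖ = (p : ℝ)⁻¹) (hd : d ≠ 0) :
    IsSquare d ∨ IsSquare (d * u) ∨ IsSquare (d * c) ∨ IsSquare (d * (u * c)) := by
  obtain ⟨z, hz, h⟩ := exists_norm_eq_sq hd hc
  have hz' : ‖z‖ ≠ 0 := norm_ne_zero_iff.mpr hz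
  have key : ∀ e : ℚ_[p], ‖e‖ = ‖z‖ ^ 2 → IsSquare e ∨ IsSquare (e * u) := by
    intro e he
    have h1 : ‖e / (z * z)‖ = 1 := by
      rw [norm_div, norm_mul, he]; field_simp
    have e1 : e = z * z * (e / (z * z)) := by field_simp
    have e2 : e * u = z * z * (e / (z * z) * u) := by field_simp
    rw [e2, e1, isSquare_mul_left_iff ⟨z, rfl⟩ (mul_ne_zero hz hz),
      isSquare_mul_left_iff ⟨z, rfl⟩ (mul_ne_zero hz hz)]
    have e3 : z * z * (e / (z * z)) / (z * z) = e / (z * z) := by field_simp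
    rw [e3]
    exact isSquare_unit_or_mul h2 hu hns h1
  rcases h with h | h
  · rcases key _ h with h | h <;> tauto
  · have e : d * c * u = d * (u * c) := by ring
    rcases key _ h with h | h
    · tauto
    · rw [e] at h; tauto

/-! ### Square classes and descent images as explicit equations -/

theorem sqClass_of_ne_zero {K : Type*} [Field K] {a : K} (ha : a ≠ 0) :
    sqClass a = QuotientGroup.mk (Units.mk0 a ha) := by
  simp [sqClass, ha]

theorem sqClass_one {K : Type*} [Field K] : sqClass (1 : K) = 1 := by
  rw [sqClass_of_ne_zero one_ne_zero, show Units.mk0 (1 : K) one_ne_zero = 1 from Units.ext rfl,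
    QuotientGroup.mk_one]

theorem sqClass_eq_iff {K : Type*} [Field K] {a b : K} (ha : a ≠ 0) (hb : b ≠ 0) :
    sqClass a = sqClass b ↔ IsSquare (a * b) := by
  rw [sqClass_of_ne_zero ha, sqClass_of_ne_zero hb, QuotientGroup.eq, Subgroup.mem_square]
  constructor
  · rintro ⟨r, hr⟩
    have h := congrArg (fun v : Kˣ => (v : K)) hr
    simp only [Units.val_mul, Units.val_inv_eq_inv_val, Units.val_mk0] at h
    refine ⟨a * r, ?_⟩
    have : b = a * (r * r) := by rw [← h]; field_simp
    rw [this]; ring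
  · rintro ⟨r, hr⟩
    have hr0 : r ≠ 0 := by
      rintro rfl
      exact mul_ne_zero ha hb (by simpa using hr)
    refine ⟨Units.mk0 (r / a) (div_ne_zero hr0 ha), ?_⟩
    ext
    simp only [Units.val_mul, Units.val_inv_eq_inv_val, Units.val_mk0]
    field_simp
    rw [sq, ← hr]

theorem sqClass_mul {K : Type*} [Field K] {a b : K} (ha : a ≠ 0) (hb : b ≠ 0) :
    sqClass (a * b) = sqClass a * sqClass b := by
  rw [sqClass_of_ne_zero ha, sqClass_of_ne_zero hb, sqClass_of_ne_zero (mul_ne_zero ha hb),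
    ← QuotientGroup.mk_mul]
  congr 1
  ext
  simp

theorem localize_sqClass (K : Type*) [Field K] [CharZero K] {q : ℚ} (hq : q ≠ 0) :
    localize K (sqClass q) = sqClass (q : K) := by
  have hq' : (q : K) ≠ 0 := by exact_mod_cast hq
  rw [sqClass_of_ne_zero hq, sqClass_of_ne_zero hq', localize, QuotientGroup.map_mk]
  congr 1
  ext
  simp

theorem curve_Δ (K : Type*) [Field K] (A B : ℤ) :
    (curve K A B).Δ = 16 * (disc A B : K) := by
  simp only [WeierstrassCurve.Δ, WeierstrassCurve.b₂, WeierstrassCurve.b₄, WeierstrassCurve.b₆,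
    WeierstrassCurve.b₈, curve, disc]
  push_cast
  ring

theorem curve_equation (K : Type*) [Field K] (A B : ℤ) (x y : K) :
    (curve K A B).toAffine.Equation x y ↔ y ^ 2 = x ^ 3 + A * x ^ 2 + B * x := by
  rw [WeierstrassCurve.Affine.equation_iff]
  simp [curve]

/-- The three alternatives are the contributions of `O`, of `(0, 0)` and of the remaining points.
Nonsingularity is automatic because the discriminant does not vanish. -/
theorem sqClass_mem_range_descentMap_iff {K : Type*} [Field K] [CharZero K] {A B : ℤ}
    (h0 : disc A B ≠ 0) {d : K} (hd : d ≠ 0) :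
    sqClass d ∈ Set.range (descentMap K A B) ↔
      IsSquare d ∨ IsSquare (d * B) ∨
        ∃ x y : K, x ≠ 0 ∧ y ^ 2 = x ^ 3 + A * x ^ 2 + B * x ∧ IsSquare (d * x) := by
  have hΔ : (curve K A B).toAffine.Δ ≠ 0 := by
    have h := curve_Δ K A B
    have : (disc A B : K) ≠ 0 := by exact_mod_cast h0
    rw [WeierstrassCurve.toAffine, h]
    exact mul_ne_zero (by norm_num) this
  have hB : (B : K) ≠ 0 := by
    rintro hB
    apply h0
    have : B = 0 := by exact_mod_cast hB
    simp [disc, this]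
  have h1 : (1 : SqClass K) = sqClass (1 : K) := sqClass_one.symm
  constructor
  · rintro ⟨P, hP⟩
    cases P with
    | zero =>
      left
      have : sqClass d = sqClass (1 : K) := by rw [← h1]; exact hP.symm
      rwa [sqClass_eq_iff hd one_ne_zero, mul_one] at this
    | some x y h =>
      right
      simp only [descentMap] at hP
      split_ifs at hP with hx
      · left
        exact (sqClass_eq_iff hd hB).mp hP.symm
      · right
        exact ⟨x, y, hx, (curve_equation K A B x y).mp h.1, (sqClass_eq_iff hd hx).mp hP.symm⟩
  · rintro (h | h | ⟨x, y, hx, hxy, h⟩)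
    · refine ⟨.zero, ?_⟩
      have : sqClass d = sqClass (1 : K) := by
        rwa [sqClass_eq_iff hd one_ne_zero, mul_one]
      rw [this, ← h1]
      rfl
    · have he : (curve K A B).toAffine.Equation 0 0 := by
        rw [curve_equation]; ring
      refine ⟨.some 0 0
        ((WeierstrassCurve.Affine.equation_iff_nonsingular_of_Δ_ne_zero hΔ).mp he), ?_⟩
      simp only [descentMap, if_true]
      exact ((sqClass_eq_iff hd hB).mpr h).symm
    · have he : (curve K A B).toAffine.Equation x y := (curve_equation K A B x y).mpr hxy
      refine ⟨.some x y
        ((WeierstrassCurve.Affine.equation_iff_nonsingular_of_Δ_ne_zero hΔ).mp he), ?_⟩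
      simp only [descentMap, if_neg hx]
      exact ((sqClass_eq_iff hd hx).mpr h).symm

/-- The class of `d` comes from a `K`-point of `y² = x (x - n) (x + 3 n)`. -/
def FromCurve (K : Type*) [Field K] (n : ℤ) (d : K) : Prop :=
  IsSquare d ∨ IsSquare (d * -3) ∨
    ∃ x y : K, x ≠ 0 ∧ y ^ 2 = x * (x ^ 2 + 2 * n * x + -3 * n ^ 2) ∧ IsSquare (d * x)

/-- The class of `d` comes from a `K`-point of `y² = x (x² - n x + n²)`, a rescaling of the
2-isogenous curve. -/
def FromIsogenous (K : Type*) [Field K] (n : ℤ) (d : K) : Prop :=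
  IsSquare d ∨ ∃ x y : K, x ≠ 0 ∧ y ^ 2 = x * (x ^ 2 + -n * x + n ^ 2) ∧ IsSquare (d * x)

theorem disc_coeff (n : ℤ) : disc (coeffA n) (coeffB n) = 144 * n ^ 6 := by
  simp only [disc, coeffA, coeffB]; ring

theorem mem_range_curve_iff {K : Type*} [Field K] [CharZero K] {n : ℤ} (hn : n ≠ 0) {d : K}
    (hd : d ≠ 0) :
    sqClass d ∈ Set.range (descentMap K (coeffA n) (coeffB n)) ↔ FromCurve K n d := by
  have h0 : disc (coeffA n) (coeffB n) ≠ 0 := by rw [disc_coeff]; positivity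
  have hn' : (n : K) ≠ 0 := by exact_mod_cast hn
  rw [sqClass_mem_range_descentMap_iff h0 hd, FromCurve]
  refine or_congr Iff.rfl (or_congr ?_ ?_)
  · have : d * (coeffB n : ℤ) = (n : K) * n * (d * -3) := by simp [coeffB]; ring
    rw [this, isSquare_mul_left_iff ⟨_, rfl⟩ (mul_ne_zero hn' hn')]
  · refine exists_congr fun x => exists_congr fun y => and_congr Iff.rfl (and_congr ?_ Iff.rfl)
    have : x ^ 3 + (coeffA n : ℤ) * x ^ 2 + (coeffB n : ℤ) * x =
        x * (x ^ 2 + 2 * n * x + -3 * n ^ 2) := by simp [coeffA, coeffB]; ring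
    rw [this]

/-- Here `E'` is `y² = x³ - 4n x² + 16n² x`, and `(x, y) ↦ (x/4, y/8)` removes the powers of 2
without changing the class of `x`. As `16n²` is a square, `(0, 0)` contributes nothing beyond `O`.
-/
theorem mem_range_isogenous_iff {K : Type*} [Field K] [CharZero K] {n : ℤ} (hn : n ≠ 0) {d : K}
    (hd : d ≠ 0) :
    sqClass d ∈ Set.range (descentMap K (-2 * coeffA n) (coeffA n ^ 2 - 4 * coeffB n)) ↔
      FromIsogenous K n d := by
  have h0 : disc (-2 * coeffA n) (coeffA n ^ 2 - 4 * coeffB n) ≠ 0 := by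
    have : disc (-2 * coeffA n) (coeffA n ^ 2 - 4 * coeffB n) = -12288 * n ^ 6 := by
      simp only [disc, coeffA, coeffB]; ring
    rw [this]
    exact mul_ne_zero (by norm_num) (pow_ne_zero _ hn)
  have hn' : (n : K) ≠ 0 := by exact_mod_cast hn
  have h4 : (4 * n : K) ≠ 0 := mul_ne_zero (by norm_num) hn'
  rw [sqClass_mem_range_descentMap_iff h0 hd, FromIsogenous]
  have e : d * ((coeffA n ^ 2 - 4 * coeffB n : ℤ) : K) = (4 * n : K) * (4 * n) * d := by
    simp [coeffA, coeffB]; ring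
  rw [e, isSquare_mul_left_iff ⟨_, rfl⟩ (mul_ne_zero h4 h4), ← or_assoc, or_self]
  refine or_congr Iff.rfl ?_
  constructor
  · rintro ⟨x, y, hx, hxy, h⟩
    refine ⟨x / 4, y / 8, by simpa using hx, ?_, ?_⟩
    · simp only [coeffA, coeffB] at hxy
      push_cast at hxy
      rw [div_pow, hxy]
      ring
    · have : d * (x / 4) = (1 / 2) * (1 / 2) * (d * x) := by ring
      rw [this]
      exact IsSquare.mul ⟨_, rfl⟩ h
  · rintro ⟨x, y, hx, hxy, h⟩
    refine ⟨4 * x, 8 * y, by simpa using hx, ?_, ?_⟩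
    · simp only [coeffA, coeffB]
      push_cast
      rw [mul_pow, hxy]
      ring
    · have : d * (4 * x) = 2 * 2 * (d * x) := by ring
      rw [this]
      exact IsSquare.mul ⟨_, rfl⟩ h

theorem fromCurve_self {K : Type*} [Field K] [CharZero K] {n : ℤ} (hn : n ≠ 0) {d : K}
    (h : IsSquare (d * n)) : FromCurve K n d :=
  Or.inr (Or.inr ⟨n, 0, by exact_mod_cast hn, by ring, h⟩)

theorem fromCurve_neg_three_mul {K : Type*} [Field K] [CharZero K] {n : ℤ} (hn : n ≠ 0) {d : K}
    (h : IsSquare (d * (-3 * n))) : FromCurve K n d :=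
  Or.inr (Or.inr ⟨-3 * n, 0, mul_ne_zero (by norm_num) (by exact_mod_cast hn), by ring, h⟩)

theorem fromCurve_of_isSquare {K : Type*} [Field K] [CharZero K] {n : ℤ} (hn : n ≠ 0)
    (hsq : IsSquare (n : K)) {d : K} (h : IsSquare (d * -1) ∨ IsSquare (d * 3)) :
    FromCurve K n d := by
  have hn' : (n : K) ≠ 0 := by exact_mod_cast hn
  obtain ⟨s, hs⟩ := hsq
  rcases h with h | h
  -- At `x = -n` and `x = 3n` the cubic takes the values `4n³` and `36n³`, which are squares once
  -- `n` is.
  · refine Or.inr (Or.inr ⟨-n, 2 * s ^ 3, neg_ne_zero.mpr hn', ?_, ?_⟩)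
    · rw [hs]; ring
    · rw [hs, show d * -(s * s) = s * s * (d * -1) by ring]
      exact IsSquare.mul ⟨_, rfl⟩ h
  · refine Or.inr (Or.inr ⟨3 * n, 6 * s ^ 3, mul_ne_zero (by norm_num) hn', ?_, ?_⟩)
    · rw [hs]; ring
    · rw [hs, show d * (3 * (s * s)) = s * s * (d * 3) by ring]
      exact IsSquare.mul ⟨_, rfl⟩ h

/-- The classes `1` and `-3` of `O` and `(0, 0)` already realize both signs. -/
theorem fromCurve_real {n : ℤ} {d : ℝ} : FromCurve ℝ n d := by
  rcases le_total 0 d with h | h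
  · exact Or.inl (Real.isSquare_iff.mpr h)
  · exact Or.inr (Or.inl (Real.isSquare_iff.mpr (by linarith)))

theorem fromIsogenous_real_iff {n : ℤ} (hn : n ≠ 0) {d : ℝ} (hd : d ≠ 0) :
    FromIsogenous ℝ n d ↔ 0 < d := by
  constructor
  · rintro (h | ⟨x, y, hx, hxy, h⟩)
    · exact lt_of_le_of_ne (Real.isSquare_iff.mp h) hd.symm
    · have hn' : (n : ℝ) ≠ 0 := by exact_mod_cast hn
      have hq : 0 < x ^ 2 + -n * x + (n : ℝ) ^ 2 := by
        have : 0 < x ^ 2 := by positivity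
        -- `4 (x² - n x + n²) = (x - 2n)² + 3x²`.
        nlinarith [sq_nonneg (x - 2 * n)]
      have hx0 : 0 < x := by
        refine lt_of_le_of_ne ?_ hx.symm
        by_contra hneg
        push Not at hneg
        nlinarith [sq_nonneg y, mul_pos_of_neg_of_neg hneg (neg_lt_zero.mpr hq)]
      have := Real.isSquare_iff.mp h
      refine lt_of_le_of_ne ?_ hd.symm
      by_contra hneg
      push Not at hneg
      nlinarith [mul_neg_of_neg_of_pos hneg hx0]
  · intro h
    exact Or.inl (Real.isSquare_iff.mpr h.le)

/-! ### Local images at primes `p ≥ 5` dividing `n` -/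

section OddPrime

variable {p : ℕ} [hp : Fact p.Prime]

theorem false_of_norm_eq {c x y : ℚ_[p]} (hc : ‖c‖ = (p : ℝ)⁻¹) (hx : ‖x‖ = ‖c‖)
    {q : ℚ_[p]} (hq : ‖q‖ = ‖c‖ ^ 2) (h : y ^ 2 = x * q) : False := by
  have hc0 : ‖c‖ ≠ 0 := by
    rw [hc]; exact inv_ne_zero (by exact_mod_cast hp.out.ne_zero)
  refine norm_eq_inv_ne_sq hc (y / c) ?_
  have := congrArg norm h
  rw [norm_pow, norm_mul, hx, hq] at this
  rw [norm_div, div_pow, this]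
  field_simp

/-- On `y² = x (x² + a x + b)` with `a`, `b` of the size of `c`, `c²`, the class of `x` is that
of `1` or `b` unless `x` has the size of `c`. -/
theorem isSquare_or_norm_eq (h2 : p ≠ 2) {a b c x y : ℚ_[p]} (ha : ‖a‖ ≤ ‖c‖)
    (hb : ‖b‖ = ‖c‖ ^ 2) (hc : c ≠ 0) (hx : x ≠ 0) (h : y ^ 2 = x * (x ^ 2 + a * x + b)) :
    IsSquare x ∨ IsSquare (x * b) ∨ ‖x‖ = ‖c‖ := by
  have hc' : 0 < ‖c‖ := norm_pos_iff.mpr hc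
  have hx' : 0 < ‖x‖ := norm_pos_iff.mpr hx
  have hxq : IsSquare (x * (x ^ 2 + a * x + b)) := ⟨y, by rw [← h, sq]⟩
  rcases lt_trichotomy ‖x‖ ‖c‖ with hlt | heq | hgt
  · right; left
    have hbpos : 0 < ‖b‖ := by rw [hb]; positivity
    -- For small `x` the constant term dominates the quadratic factor, so that factor has the class
    -- of `b`.
    have hnear : ‖(x ^ 2 + a * x + b) - b‖ < ‖b‖ := by
      rw [add_sub_cancel_right]
      refine (Padic.nonarchimedean _ _).trans_lt (max_lt ?_ ?_)
      · rw [norm_pow, hb]; gcongr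
      · rw [norm_mul, hb, sq]
        exact mul_lt_mul' ha hlt hx'.le hc'
    have hq0 : x ^ 2 + a * x + b ≠ 0 := by
      intro h0
      rw [h0, zero_sub, norm_neg] at hnear
      exact lt_irrefl _ hnear
    exact isSquare_mul_trans hq0 hxq (isSquare_of_norm_sub_lt h2 hnear)
  · exact Or.inr (Or.inr heq)
  · left
    -- For large `x` the leading term dominates, so the quadratic factor is a square.
    have hnear : ‖(x ^ 2 + a * x + b) - x ^ 2‖ < ‖x ^ 2‖ := by
      rw [show (x ^ 2 + a * x + b) - x ^ 2 = a * x + b by ring]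
      refine (Padic.nonarchimedean _ _).trans_lt (max_lt ?_ ?_)
      · rw [norm_mul, norm_pow, sq]
        exact mul_lt_mul_of_pos_right (ha.trans_lt hgt) hx'
      · rw [hb, norm_pow]; gcongr
    have hq0 : x ^ 2 + a * x + b ≠ 0 := by
      intro h0
      rw [h0, zero_sub, norm_neg] at hnear
      exact lt_irrefl _ hnear
    have := isSquare_mul_trans hq0 hxq (isSquare_of_norm_sub_lt h2 hnear)
    exact (isSquare_mul_right_iff ⟨x, sq x⟩ (pow_ne_zero 2 hx)).mp this

/-- On `y² = x (x - r) (x - s)` with `x`, `r`, `s` all of the size of a uniformizer, the class of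
`x` is that of `r` or `s`. -/
theorem isSquare_mul_root (h2 : p ≠ 2) {c r s x y : ℚ_[p]} (hc : ‖c‖ = (p : ℝ)⁻¹)
    (hr : ‖r‖ = ‖c‖) (hs : ‖s‖ = ‖c‖) (hx : ‖x‖ = ‖c‖) (h : y ^ 2 = x * ((x - r) * (x - s))) :
    IsSquare (x * r) ∨ IsSquare (x * s) := by
  by_cases h1 : ‖x - r‖ < ‖r‖
  · exact Or.inl (isSquare_of_norm_sub_lt h2 h1)
  by_cases h3 : ‖x - s‖ < ‖s‖
  · exact Or.inr (isSquare_of_norm_sub_lt h2 h3)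
  exfalso
  -- If `x` is close to neither root, all three factors have valuation 1, and `y²` would have
  -- valuation 3.
  have key : ∀ r : ℚ_[p], ‖r‖ = ‖c‖ → ¬ ‖x - r‖ < ‖r‖ → ‖x - r‖ = ‖c‖ := by
    intro r hr h1
    refine le_antisymm ?_ (hr ▸ not_lt.mp h1)
    have := Padic.nonarchimedean x (-r)
    rwa [← sub_eq_add_neg, norm_neg, hr, hx, max_self] at this
  refine false_of_norm_eq hc hx ?_ h
  rw [norm_mul, key r hr h1, key s hs h3, sq]

theorem norm_intCast_of_not_dvd {a : ℤ} (ha : ¬ (p : ℤ) ∣ a) : ‖(a : ℚ_[p])‖ = 1 :=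
  le_antisymm (Padic.norm_int_le_one a) (not_lt.mp fun h => ha (Padic.norm_intCast_lt_one_iff.mp h))

theorem norm_intCast_of_dvd {a : ℤ} (h1 : (p : ℤ) ∣ a) (h2 : ¬ (p : ℤ) ^ 2 ∣ a) :
    ‖(a : ℚ_[p])‖ = (p : ℝ)⁻¹ := by
  obtain ⟨b, rfl⟩ := h1
  have hb : ¬ (p : ℤ) ∣ b := fun h => h2 (by rw [sq]; exact mul_dvd_mul_left _ h)
  push_cast
  rw [norm_mul, norm_intCast_of_not_dvd hb, Padic.norm_p, mul_one]

theorem norm_three (h5 : 5 ≤ p) : ‖(3 : ℚ_[p])‖ = 1 := by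
  have := norm_intCast_of_not_dvd (p := p) (a := 3) (fun h => by
    have := Int.le_of_dvd (by norm_num) h
    omega)
  exact_mod_cast this

/-- A point with `‖x‖ ≠ ‖n‖` has the class `1` or `-3`, now both trivial. Otherwise `x` has the
class of a root `n` or `-3n`, and these coincide. -/
theorem fromCurve_iff_of_isSquare_neg_three (h5 : 5 ≤ p) {n : ℤ}
    (hn : ‖(n : ℚ_[p])‖ = (p : ℝ)⁻¹) (h3 : IsSquare (-3 : ℚ_[p])) {d : ℚ_[p]} :
    FromCurve ℚ_[p] n d ↔ IsSquare d ∨ IsSquare (d * (-3 * n)) := by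
  have h2 : p ≠ 2 := by omega
  have hp0 : (p : ℝ)⁻¹ ≠ 0 := inv_ne_zero (by exact_mod_cast hp.out.ne_zero)
  have hn0 : (n : ℚ_[p]) ≠ 0 := by rw [← norm_ne_zero_iff, hn]; exact hp0
  have hnz : n ≠ 0 := by exact_mod_cast hn0
  have h30 : (-3 : ℚ_[p]) ≠ 0 := by norm_num
  have hn3 : ‖(-3 * n : ℚ_[p])‖ = ‖(n : ℚ_[p])‖ := by
    rw [norm_mul, norm_neg, norm_three h5, one_mul]
  constructor
  · rintro (h | h | ⟨x, y, hx, hxy, h⟩)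
    · exact Or.inl h
    · exact Or.inl ((isSquare_mul_right_iff h3 h30).mp h)
    · have hsq : IsSquare (-3 * (n : ℚ_[p]) ^ 2) := h3.mul ⟨_, sq _⟩
      rcases isSquare_or_norm_eq h2 (c := (n : ℚ_[p])) (a := 2 * n) (b := -3 * n ^ 2)
        (by rw [norm_mul, norm_two_of_ne_two h2, one_mul])
        (by rw [norm_mul, norm_neg, norm_three h5, one_mul, norm_pow]) hn0 hx hxy with h' | h' | h'
      · exact Or.inl ((isSquare_mul_right_iff h' hx).mp h)
      · have := (isSquare_mul_right_iff hsq (mul_ne_zero h30 (pow_ne_zero 2 hn0))).mp h'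
        exact Or.inl ((isSquare_mul_right_iff this hx).mp h)
      · right
        rcases isSquare_mul_root h2 (r := n) (s := -3 * n) hn rfl hn3 h'
          (hxy.trans (by ring)) with h'' | h''
        · have := isSquare_mul_trans hx h h''
          rw [show d * (-3 * n) = -3 * (d * n) by ring]
          exact h3.mul this
        · exact isSquare_mul_trans hx h h''
  · rintro (h | h)
    · exact Or.inl h
    · exact fromCurve_neg_three_mul hnz h

/-- With a primitive cube root of unity `ω` the quadratic factor splits as `(x + nω)(x + nω²)`.
Since `ω = (ω²)²`, both roots have the class of `-n`. -/
theorem fromIsogenous_iff_of_isSquare_neg_three (h5 : 5 ≤ p) {n : ℤ}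
    (hn : ‖(n : ℚ_[p])‖ = (p : ℝ)⁻¹) (h3 : IsSquare (-3 : ℚ_[p])) {d : ℚ_[p]} :
    FromIsogenous ℚ_[p] n d ↔ IsSquare d ∨ IsSquare (d * -n) := by
  have h2 : p ≠ 2 := by omega
  have hp0 : (p : ℝ)⁻¹ ≠ 0 := inv_ne_zero (by exact_mod_cast hp.out.ne_zero)
  have hn0 : (n : ℚ_[p]) ≠ 0 := by rw [← norm_ne_zero_iff, hn]; exact hp0
  obtain ⟨s, hs⟩ := h3
  obtain ⟨ω, hω⟩ : ∃ ω : ℚ_[p], ω ^ 2 + ω + 1 = 0 := ⟨(-1 + s) / 2, by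
    linear_combination (-1 / 4) * hs⟩
  have hω3 : ω ^ 3 = 1 := by linear_combination (ω - 1) * hω
  have hω0 : ω ≠ 0 := by rintro rfl; norm_num at hω
  have hωn : ‖ω‖ = 1 := by
    have := congrArg norm hω3
    rw [norm_pow, norm_one] at this
    exact (pow_eq_one_iff_of_nonneg (norm_nonneg _) (by norm_num)).mp this
  constructor
  · rintro (h | ⟨x, y, hx, hxy, h⟩)
    · exact Or.inl h
    · rcases isSquare_or_norm_eq h2 (c := (n : ℚ_[p])) (a := -n) (b := n ^ 2)
        (norm_neg _).le (norm_pow _ _) hn0 hx hxy with h' | h' | h'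
      · exact Or.inl ((isSquare_mul_right_iff h' hx).mp h)
      · have := (isSquare_mul_right_iff ⟨_, sq _⟩ (pow_ne_zero 2 hn0)).mp h'
        exact Or.inl ((isSquare_mul_right_iff this hx).mp h)
      · right
        rcases isSquare_mul_root h2 (r := -n * ω) (s := -n * ω ^ 2) hn
          (by rw [norm_mul, norm_neg, hωn, mul_one])
          (by rw [norm_mul, norm_neg, norm_pow, hωn, one_pow, mul_one]) h'
          (hxy.trans (by linear_combination (-x ^ 2 * n - x * n ^ 2 * (ω - 1)) * hω)) with h'' | h''
        · have := isSquare_mul_trans hx h h''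
          rw [show d * (-n * ω) = d * -n * ω by ring] at this
          refine (isSquare_mul_right_iff ⟨ω ^ 2, ?_⟩ hω0).mp this
          linear_combination -ω * hω3
        · have := isSquare_mul_trans hx h h''
          rw [show d * (-n * ω ^ 2) = d * -n * ω ^ 2 by ring] at this
          exact (isSquare_mul_right_iff ⟨ω, sq ω⟩ (pow_ne_zero 2 hω0)).mp this
  · rintro (h | h)
    · exact Or.inl h
    · refine Or.inr ⟨-n * ω ^ 2, 0, mul_ne_zero (neg_ne_zero.mpr hn0) (pow_ne_zero 2 hω0), ?_, ?_⟩
      · linear_combination (n ^ 3 * ω ^ 2 * (ω ^ 2 - ω + 1) : ℚ_[p]) * hω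
      · rw [show d * (-n * ω ^ 2) = d * -n * ω ^ 2 by ring]
        exact h.mul ⟨ω, sq ω⟩

/-- The four 2-torsion points have the classes `1`, `-3`, `n`, `-3n`, which exhaust the square
classes: `-3` is a non-square unit and `n` a uniformizer. -/
theorem fromCurve_of_not_isSquare_neg_three (h5 : 5 ≤ p) {n : ℤ}
    (hn : ‖(n : ℚ_[p])‖ = (p : ℝ)⁻¹) (h3 : ¬ IsSquare (-3 : ℚ_[p])) {d : ℚ_[p]} (hd : d ≠ 0) :
    FromCurve ℚ_[p] n d := by
  have hp0 : (p : ℝ)⁻¹ ≠ 0 := inv_ne_zero (by exact_mod_cast hp.out.ne_zero)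
  have hn0 : (n : ℚ_[p]) ≠ 0 := by rw [← norm_ne_zero_iff, hn]; exact hp0
  have hnz : n ≠ 0 := by exact_mod_cast hn0
  rcases isSquare_mul_one_of_four (by omega) (by rw [norm_neg, norm_three h5]) h3 hn hd with
    h | h | h | h
  · exact Or.inl h
  · exact Or.inr (Or.inl h)
  · exact fromCurve_self hnz h
  · exact fromCurve_neg_three_mul hnz h

theorem fromIsogenous_iff_of_not_isSquare_neg_three (h5 : 5 ≤ p) {n : ℤ}
    (hn : ‖(n : ℚ_[p])‖ = (p : ℝ)⁻¹) (h3 : ¬ IsSquare (-3 : ℚ_[p])) {d : ℚ_[p]} :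
    FromIsogenous ℚ_[p] n d ↔ IsSquare d := by
  have h2 : p ≠ 2 := by omega
  have hp0 : (p : ℝ)⁻¹ ≠ 0 := inv_ne_zero (by exact_mod_cast hp.out.ne_zero)
  have hn0 : (n : ℚ_[p]) ≠ 0 := by rw [← norm_ne_zero_iff, hn]; exact hp0
  refine ⟨?_, Or.inl⟩
  rintro (h | ⟨x, y, hx, hxy, h⟩)
  · exact h
  · rcases isSquare_or_norm_eq h2 (c := (n : ℚ_[p])) (a := -n) (b := n ^ 2)
      (norm_neg _).le (norm_pow _ _) hn0 hx hxy with h' | h' | h'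
    · exact (isSquare_mul_right_iff h' hx).mp h
    · have := (isSquare_mul_right_iff ⟨_, sq _⟩ (pow_ne_zero 2 hn0)).mp h'
      exact (isSquare_mul_right_iff this hx).mp h
    · exfalso
      refine false_of_norm_eq hn h' ?_ hxy
      refine le_antisymm ?_ (not_lt.mp fun hlt => h3 ?_)
      · refine (Padic.nonarchimedean _ _).trans (max_le ((Padic.nonarchimedean _ _).trans
          (max_le ?_ ?_)) ?_)
        · rw [norm_pow, h']
        · rw [norm_mul, norm_neg, h', sq]
        · rw [norm_pow]
      -- Completing the square: if the quadratic factor were smaller than `n²`, then `-3n²` would be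
      -- close to a square and `-3` itself a square.
      · have hnear : ‖(2 * x - n) ^ 2 - -3 * (n : ℚ_[p]) ^ 2‖ < ‖-3 * (n : ℚ_[p]) ^ 2‖ := by
          rw [show (2 * x - n) ^ 2 - -3 * (n : ℚ_[p]) ^ 2 =
            2 * 2 * (x ^ 2 + -n * x + (n : ℚ_[p]) ^ 2) by ring, norm_mul, norm_mul,
            norm_two_of_ne_two h2, norm_mul, norm_neg, norm_three h5, norm_pow]
          simpa using hlt
        have hne : 2 * x - n ≠ 0 := by
          intro h0
          rw [h0, zero_pow two_ne_zero, zero_sub, norm_neg] at hnear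
          exact lt_irrefl _ hnear
        have := (isSquare_mul_left_iff ⟨_, sq _⟩ (pow_ne_zero 2 hne)).mp
          (isSquare_of_norm_sub_lt h2 hnear)
        exact (isSquare_mul_right_iff ⟨_, sq _⟩ (pow_ne_zero 2 hn0)).mp this

/-- `-3` is the discriminant of `w² + w + 1`, so it is a square mod `p` exactly when `𝔽_pˣ` has an
element of order 3. -/
theorem isSquare_neg_three_iff (h5 : 5 ≤ p) : IsSquare (-3 : ℚ_[p]) ↔ p ≡ 1 [MOD 3] := by
  have h2 : p ≠ 2 := by omega
  have hnd : ¬ (p : ℤ) ∣ -3 := fun h => by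
    have := Int.le_of_dvd (by norm_num) ((dvd_neg).mp h)
    omega
  have h0 : ((-3 : ℤ) : ZMod p) ≠ 0 := by rwa [Ne, ZMod.intCast_zmod_eq_zero_iff_dvd]
  have h30 : (3 : ZMod p) ≠ 0 := by
    intro h; apply h0; push_cast; rw [h, neg_zero]
  have h20 : (2 : ZMod p) ≠ 0 := by
    intro h
    have : ((2 : ℕ) : ZMod p) = 0 := by exact_mod_cast h
    rw [ZMod.natCast_eq_zero_iff] at this
    exact absurd (Nat.le_of_dvd (by norm_num) this) (by omega)
  have e : (-3 : ℚ_[p]) = ((-3 : ℤ) : ℚ_[p]) := by push_cast; rfl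
  rw [e, isSquare_intCast_iff h2 hnd, legendreSym.eq_one_iff p h0]
  push_cast
  have hcard : Fintype.card (ZMod p)ˣ = p - 1 := ZMod.card_units p
  constructor
  · rintro ⟨s, hs⟩
    set w : ZMod p := (-1 + s) / 2
    have hw : w ^ 2 + w + 1 = 0 := by
      simp only [w]; field_simp; linear_combination -hs
    have hw3 : w ^ 3 = 1 := by linear_combination (w - 1) * hw
    have hw0 : w ≠ 0 := by intro h; rw [h] at hw3; simp at hw3
    have hw1 : w ≠ 1 := by intro h; rw [h] at hw; apply h30; linear_combination hw
    have ho : orderOf (Units.mk0 w hw0) = 3 := by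
      refine orderOf_eq_prime (Units.ext (by simpa using hw3)) fun h => hw1 ?_
      simpa using congrArg Units.val h
    have := orderOf_dvd_card (x := Units.mk0 w hw0)
    rw [ho, hcard] at this
    exact ((Nat.modEq_iff_dvd' (by omega)).mpr this).symm
  · intro h
    have hd : 3 ∣ Fintype.card (ZMod p)ˣ := by
      rw [hcard]; exact (Nat.modEq_iff_dvd' (by omega)).mp h.symm
    obtain ⟨u, hu⟩ := exists_prime_orderOf_dvd_card 3 hd
    have hu3 : (u : ZMod p) ^ 3 = 1 := by
      have := pow_orderOf_eq_one u
      rw [hu] at this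
      simpa using congrArg Units.val this
    have hu1 : (u : ZMod p) - 1 ≠ 0 := by
      intro h
      have : u = 1 := Units.ext (by simpa using sub_eq_zero.mp h)
      rw [this, orderOf_one] at hu
      norm_num at hu
    have hq : (u : ZMod p) ^ 2 + u + 1 = 0 := by
      refine (mul_eq_zero.mp (?_ : ((u : ZMod p) - 1) * _ = 0)).resolve_left hu1
      linear_combination hu3
    exact ⟨2 * u + 1, by linear_combination (-4) * hq⟩

end OddPrime

/-! ### Local images at `3` -/

section Three

theorem not_isSquare_three_of_modEq {a : ℤ} (ha : a ≡ 2 [ZMOD 3]) : ¬ IsSquare (a : ℚ_[3]) := by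
  have h3 : ¬ ((3 : ℕ) : ℤ) ∣ a := by
    unfold Int.ModEq at ha; omega
  rw [isSquare_intCast_iff (by norm_num) h3, legendreSym.mod]
  have : a % ((3 : ℕ) : ℤ) = 2 := ha
  rw [this]
  decide

theorem isSquare_three_of_modEq {a : ℤ} (ha : a ≡ 1 [ZMOD 3]) : IsSquare (a : ℚ_[3]) := by
  have h3 : ¬ ((3 : ℕ) : ℤ) ∣ a := by
    unfold Int.ModEq at ha; omega
  rw [isSquare_intCast_iff (by norm_num) h3, legendreSym.mod]
  have : a % ((3 : ℕ) : ℤ) = 1 := ha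
  rw [this]
  decide

/-- If `n ≡ 2 (mod 3)` the 2-torsion points fill all four classes. If `n ≡ 1 (mod 3)`, then `n` is a
square and the missing classes `-1` and `3` come from `x = -n` and `x = 3n`. -/
theorem fromCurve_three {n : ℤ} (hn : ¬ 3 ∣ n) {d : ℚ_[3]} (hd : d ≠ 0) :
    FromCurve ℚ_[3] n d := by
  have hnz : n ≠ 0 := by rintro rfl; simp at hn
  have hc : ‖(-3 : ℚ_[3])‖ = ((3 : ℕ) : ℝ)⁻¹ := by
    rw [norm_neg]; exact_mod_cast Padic.norm_p (p := 3)
  have hmod : n ≡ 1 [ZMOD 3] ∨ n ≡ 2 [ZMOD 3] := by unfold Int.ModEq; omega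
  rcases hmod with h | h
  · have hns : ¬ IsSquare (-1 : ℚ_[3]) := by
      have := not_isSquare_three_of_modEq (a := -1) (by decide)
      exact_mod_cast this
    have hsq := isSquare_three_of_modEq h
    rcases isSquare_mul_one_of_four (by norm_num) (by rw [norm_neg, norm_one]) hns hc hd with
      h | h | h | h
    · exact Or.inl h
    · exact fromCurve_of_isSquare hnz hsq (Or.inl h)
    · exact Or.inr (Or.inl h)
    · exact fromCurve_of_isSquare hnz hsq (Or.inr (by rwa [show d * 3 = d * (-1 * -3) by ring]))
  · rcases isSquare_mul_one_of_four (by norm_num) (norm_intCast_of_not_dvd (a := n) hn)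
      (not_isSquare_three_of_modEq h) hc hd with h | h | h | h
    · exact Or.inl h
    · exact fromCurve_self hnz h
    · exact Or.inr (Or.inl h)
    · exact fromCurve_neg_three_mul hnz (by rwa [mul_comm (-3 : ℚ_[3])])

theorem fromIsogenous_three_iff {n : ℤ} (hn : ¬ 3 ∣ n) {d : ℚ_[3]} :
    FromIsogenous ℚ_[3] n d ↔ IsSquare d := by
  refine ⟨?_, Or.inl⟩
  have hnz : n ≠ 0 := by rintro rfl; simp at hn
  have hn0 : (n : ℚ_[3]) ≠ 0 := by exact_mod_cast hnz
  have hn1 : ‖(n : ℚ_[3])‖ = 1 := norm_intCast_of_not_dvd (a := n) hn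
  rintro (h | ⟨x, y, hx, hxy, h⟩)
  · exact h
  refine (isSquare_mul_right_iff ?_ hx).mp h
  rcases isSquare_or_norm_eq (by norm_num) (c := (n : ℚ_[3])) (a := -n) (b := n ^ 2)
      (norm_neg _).le (norm_pow _ _) hn0 hx hxy with h' | h' | h'
  · exact h'
  · exact (isSquare_mul_right_iff ⟨_, sq _⟩ (pow_ne_zero 2 hn0)).mp h'
  rw [hn1] at h'
  -- For a unit `x`, either `x ≡ n (mod 3)` and the quadratic factor is close to `n²`, or `x ≡ -n`
  -- and the factor `(x + n)² - 3nx` has valuation exactly 1, which is impossible.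
  have hlt : ‖x - n‖ < 1 ∨ ‖x + n‖ < 1 := by
    set x' : ℤ_[3] := ⟨x, h'.le⟩
    have hz : ∀ a b : ZMod 3, a ≠ 0 → b ≠ 0 → a - b = 0 ∨ a + b = 0 := by decide
    have h1 : PadicInt.toZMod x' ≠ 0 := by
      rw [Ne, toZMod_eq_zero_iff, show ‖x'‖ = 1 from h']; exact lt_irrefl _
    have h2 : PadicInt.toZMod (n : ℤ_[3]) ≠ 0 := by
      rw [Ne, toZMod_eq_zero_iff, PadicInt.norm_intCast_eq_padic_norm, hn1]; exact lt_irrefl _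
    rcases hz _ _ h1 h2 with h | h
    · rw [← map_sub, toZMod_eq_zero_iff] at h
      exact Or.inl h
    · rw [← map_add, toZMod_eq_zero_iff] at h
      exact Or.inr h
  rcases hlt with hlt | hlt
  · have hnear : ‖(x ^ 2 + -n * x + (n : ℚ_[3]) ^ 2) - n ^ 2‖ < ‖(n : ℚ_[3]) ^ 2‖ := by
      rw [show (x ^ 2 + -n * x + (n : ℚ_[3]) ^ 2) - n ^ 2 = x * (x - n) by ring, norm_mul, h',
        one_mul, norm_pow, hn1, one_pow]
      exact hlt
    have hq0 : x ^ 2 + -n * x + (n : ℚ_[3]) ^ 2 ≠ 0 := by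
      intro h0
      rw [h0, zero_sub, norm_neg] at hnear
      exact lt_irrefl _ hnear
    have := isSquare_mul_trans hq0 ⟨y, by rw [← hxy, sq]⟩ (isSquare_of_norm_sub_lt (by norm_num) hnear)
    exact (isSquare_mul_right_iff ⟨_, sq _⟩ (pow_ne_zero 2 hn0)).mp this
  · exfalso
    have hle : ‖x + n‖ ≤ (3 : ℝ)⁻¹ := by
      have := (Padic.norm_lt_pow_iff_norm_le_pow_sub_one (p := 3) (x + n) 0).mp (by simpa using hlt)
      simpa using this
    have h3 : ‖(3 : ℚ_[3])‖ = (3 : ℝ)⁻¹ := by exact_mod_cast Padic.norm_p (p := 3)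
    have hb : ‖-3 * n * x‖ = (3 : ℝ)⁻¹ := by
      rw [norm_mul, norm_mul, norm_neg, h3, hn1, h', mul_one, mul_one]
    have ha : ‖(x + n) ^ 2‖ < ‖-3 * n * x‖ := by
      rw [hb, norm_pow]
      have := pow_le_pow_left₀ (norm_nonneg _) hle 2
      norm_num at this ⊢
      linarith
    have hq : ‖x ^ 2 + -n * x + (n : ℚ_[3]) ^ 2‖ = (3 : ℝ)⁻¹ := by
      rw [show x ^ 2 + -n * x + (n : ℚ_[3]) ^ 2 = (x + n) ^ 2 + -3 * n * x by ring,
        Padic.add_eq_max_of_ne ha.ne, max_eq_right ha.le, hb]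
    refine norm_eq_inv_ne_sq (p := 3) (c := x ^ 2 + -n * x + (n : ℚ_[3]) ^ 2)
      (by rw [hq]; norm_num) y ?_
    rw [← norm_pow, hxy, norm_mul, h', one_mul]

end Three

/-! ### Local images at `2` -/

section Two

/-- The quadratic factor has norm 1 when `‖x‖ < 1` and norm `‖x‖²` when `‖x‖ > 1`, so `x` always has
even valuation. At `2` this rules out even square-free `d`. -/
theorem norm_eq_sq_of_equation {p : ℕ} [hp : Fact p.Prime] {a b x y : ℚ_[p]} (ha : ‖a‖ ≤ 1)
    (hb : ‖b‖ = 1) (hx : x ≠ 0) (h : y ^ 2 = x * (x ^ 2 + a * x + b)) :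
    ∃ z : ℚ_[p], z ≠ 0 ∧ ‖x‖ = ‖z‖ ^ 2 := by
  have hx' : 0 < ‖x‖ := norm_pos_iff.mpr hx
  have hy := congrArg norm h
  rw [norm_pow, norm_mul] at hy
  have main : ∃ z : ℚ_[p], ‖x‖ = ‖z‖ ^ 2 := by
    rcases lt_trichotomy ‖x‖ 1 with hlt | heq | hgt
    · have hsmall : ‖x ^ 2 + a * x‖ < ‖b‖ := by
        rw [hb]
        refine (Padic.nonarchimedean _ _).trans_lt (max_lt ?_ ?_)
        · rw [norm_pow]; exact pow_lt_one₀ hx'.le hlt two_ne_zero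
        · rw [norm_mul]; nlinarith [norm_nonneg a]
      rw [Padic.add_eq_max_of_ne hsmall.ne, max_eq_right hsmall.le, hb, mul_one] at hy
      exact ⟨y, hy.symm⟩
    · exact ⟨1, by rw [heq, norm_one, one_pow]⟩
    · have hsmall : ‖a * x + b‖ < ‖x ^ 2‖ := by
        rw [norm_pow]
        refine (Padic.nonarchimedean _ _).trans_lt (max_lt ?_ ?_)
        · rw [norm_mul]; nlinarith [norm_nonneg a]
        · rw [hb]; nlinarith
      rw [add_assoc, Padic.add_eq_max_of_ne hsmall.ne', max_eq_left hsmall.le, norm_pow] at hy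
      refine ⟨y / x, ?_⟩
      rw [norm_div, div_pow, hy]
      field_simp
  obtain ⟨z, hz⟩ := main
  refine ⟨z, ?_, hz⟩
  rintro rfl
  rw [hz, norm_zero] at hx'
  norm_num at hx'

theorem not_isSquare_mul_of_norm_eq_sq {p : ℕ} [hp : Fact p.Prime] {d x z : ℚ_[p]}
    (hd : ‖d‖ = (p : ℝ)⁻¹) (hz : z ≠ 0) (hx : ‖x‖ = ‖z‖ ^ 2) : ¬ IsSquare (d * x) := by
  rintro ⟨w, hw⟩
  have hz' : ‖z‖ ≠ 0 := norm_ne_zero_iff.mpr hz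
  refine norm_eq_inv_ne_sq hd (w / z) ?_
  have h := congrArg norm hw
  rw [norm_mul, norm_mul, hx] at h
  rw [norm_div, div_pow, sq ‖w‖, ← h]
  field_simp

theorem isSquare_two_of_modEq {a : ℤ} (ha : a ≡ 1 [ZMOD 8]) : IsSquare (a : ℚ_[2]) := by
  have h2 : ‖(2 : ℚ_[2])‖ = 2⁻¹ := by exact_mod_cast Padic.norm_p (p := 2)
  have hle : ‖((a - 1 : ℤ) : ℚ_[2])‖ ≤ ((2 : ℕ) : ℝ) ^ (-(3 : ℕ) : ℤ) := by
    rw [Padic.norm_int_le_pow_iff_dvd]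
    exact ha.symm.dvd
  have := isSquare_one_add_of_norm_lt (p := 2) (t := ((a - 1 : ℤ) : ℚ_[2]))
    (hle.trans_lt (by rw [h2]; norm_num))
  simpa using this

theorem isSquare_two_mul {d c : ℤ} (h : d * c % 8 = 1) : IsSquare ((d : ℚ_[2]) * c) := by
  have := isSquare_two_of_modEq (a := d * c) h
  exact_mod_cast this

theorem modEq_of_isSquare_two {d : ℤ} (hd : Odd d) (h : IsSquare (d : ℚ_[2])) :
    d ≡ 1 [ZMOD 4] := by
  obtain ⟨w, hw⟩ := h
  have hw1 : ‖w‖ ≤ 1 := by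
    have : ‖w‖ * ‖w‖ ≤ 1 := by rw [← norm_mul, ← hw]; exact Padic.norm_int_le_one d
    nlinarith [norm_nonneg w]
  let w' : ℤ_[2] := ⟨w, hw1⟩
  have hww : (d : ℤ_[2]) = w' * w' := PadicInt.ext hw
  have h4 := congrArg (PadicInt.toZModPow 2) hww
  rw [map_intCast, map_mul] at h4
  generalize PadicInt.toZModPow 2 w' = v at h4
  have hv : ∀ v : ZMod 4, v * v = 0 ∨ v * v = 1 := by decide
  rw [Int.odd_iff] at hd
  rcases hv v with h | h
  · rw [h] at h4
    have := (ZMod.intCast_zmod_eq_zero_iff_dvd d 4).mp h4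
    omega
  · rw [h] at h4
    exact (ZMod.intCast_eq_intCast_iff d 1 4).mp (by simpa using h4)

/-- An affine coordinate written with integral homogeneous coordinates, one of which is `1`. -/
theorem exists_integral_coords {p : ℕ} [hp : Fact p.Prime] (u : ℚ_[p]) :
    ∃ M e : ℤ_[p], (M = 1 ∨ e = 1) ∧ (e : ℚ_[p]) ≠ 0 ∧ u * e = M := by
  rcases le_total ‖u‖ 1 with h | h
  · exact ⟨⟨u, h⟩, 1, Or.inr rfl, by simp, by simp⟩
  · have hu : u ≠ 0 := by
      rintro rfl
      rw [norm_zero] at h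
      norm_num at h
    refine ⟨1, ⟨u⁻¹, ?_⟩, Or.inl rfl, inv_ne_zero hu, mul_inv_cancel₀ hu⟩
    rw [norm_inv]
    exact inv_le_one_of_one_le₀ h

/-- A point with `x` in the class of the unit `d` gives a primitive integral solution of the
corresponding homogeneous space. -/
theorem exists_homogeneous {d a b : ℤ_[2]} (hd0 : (d : ℚ_[2]) ≠ 0) {x y : ℚ_[2]} (hx : x ≠ 0)
    (h : y ^ 2 = x * (x ^ 2 + a * x + b)) (hsq : IsSquare (d * x)) :
    ∃ M e w : ℤ_[2], (M = 1 ∨ e = 1) ∧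
      w ^ 2 = d * ((d * M ^ 2) ^ 2 + a * (d * M ^ 2) * e ^ 2 + b * (e ^ 2) ^ 2) := by
  obtain ⟨r, hr⟩ := hsq
  have hr0 : r ≠ 0 := by
    rintro rfl
    exact mul_ne_zero hd0 hx (by simpa using hr)
  have hxu : x = d * (r / d) ^ 2 := by field_simp; rw [sq, ← hr]; ring
  have hu0 : r / d ≠ 0 := div_ne_zero hr0 hd0
  set u := r / (d : ℚ_[2])
  obtain ⟨M, e, hMe, he, hM⟩ := exists_integral_coords u
  -- Substitute `x = d u²` and `u = M / e`, divide by `u²` and multiply by `e⁴`. The right side is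
  -- integral, hence so is `w = (y / u) e²`.
  have hw : (y / u * e ^ 2) ^ 2 =
      ((d * ((d * M ^ 2) ^ 2 + a * (d * M ^ 2) * e ^ 2 + b * (e ^ 2) ^ 2) : ℤ_[2]) : ℚ_[2]) := by
    push_cast
    rw [← hM, mul_pow, div_pow, h, hxu]
    field_simp
  have hw1 : ‖y / u * (e : ℚ_[2]) ^ 2‖ ≤ 1 := by
    have h1 := congrArg norm hw
    rw [norm_pow, PadicInt.padic_norm_e_of_padicInt] at h1
    have h3 := PadicInt.norm_le_one (d * ((d * M ^ 2) ^ 2 + a * (d * M ^ 2) * e ^ 2 + b * (e ^ 2) ^ 2))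
    rw [← h1] at h3
    exact (pow_le_one_iff_of_nonneg (norm_nonneg _) two_ne_zero).mp h3
  let w : ℤ_[2] := ⟨_, hw1⟩
  refine ⟨M, e, w, hMe, PadicInt.ext ?_⟩
  rw [PadicInt.coe_pow]
  exact hw

theorem sq_zmod_eight (w : ZMod 8) : w ^ 2 = 0 ∨ w ^ 2 = 1 ∨ w ^ 2 = 4 := by
  revert w; decide

theorem sq_zmod_thirtytwo (w : ZMod 32) : w ^ 2 = 0 ∨ w ^ 2 = 1 ∨ w ^ 2 = 4 ∨ w ^ 2 = 9 ∨
    w ^ 2 = 16 ∨ w ^ 2 = 17 ∨ w ^ 2 = 25 := by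
  revert w; decide

theorem isogenous_no_solution {n d M e w : ZMod 8} (hn : n = 1 ∨ n = 3 ∨ n = 7)
    (hd : d = 3 ∨ d = 7) (hMe : M = 1 ∨ e = 1)
    (h : w ^ 2 = d * ((d * M ^ 2) ^ 2 + -n * (d * M ^ 2) * e ^ 2 + n ^ 2 * (e ^ 2) ^ 2)) :
    False := by
  have hMe' : M ^ 2 = 1 ∨ e ^ 2 = 1 := by
    rcases hMe with rfl | rfl
    · exact Or.inl (one_pow 2)
    · exact Or.inr (one_pow 2)
  have hM := sq_zmod_eight M
  have he := sq_zmod_eight e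
  have hw := sq_zmod_eight w
  generalize M ^ 2 = M at *
  generalize e ^ 2 = e at *
  generalize w ^ 2 = w at *
  subst h
  rcases hMe' with rfl | rfl
  · clear hM
    rcases hn with rfl | rfl | rfl <;> rcases hd with rfl | rfl <;>
      rcases he with rfl | rfl | rfl <;> revert hw <;> decide
  · clear he
    rcases hn with rfl | rfl | rfl <;> rcases hd with rfl | rfl <;>
      rcases hM with rfl | rfl | rfl <;> revert hw <;> decide

/-- Here `s` is `M²` when `e = 1` and `e²` when `M = 1`, so it runs over the squares mod 32. Modulo
16 there is no contradiction: `n = 5`, `d = 3`, `M = e = 1` gives `-108 ≡ 4`. -/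
theorem curve_no_solution_aux : ∀ n ∈ ({5, 13, 21, 29} : Finset (ZMod 32)),
    ∀ d ∈ ({3, 7, 11, 15, 19, 23, 27, 31} : Finset (ZMod 32)),
    ∀ s ∈ ({0, 1, 4, 9, 16, 17, 25} : Finset (ZMod 32)),
      d * ((d * s) ^ 2 + 2 * n * (d * s) + -3 * n ^ 2) ∉
        ({0, 1, 4, 9, 16, 17, 25} : Finset (ZMod 32)) ∧
      d * (d ^ 2 + 2 * n * d * s + -3 * n ^ 2 * s ^ 2) ∉
        ({0, 1, 4, 9, 16, 17, 25} : Finset (ZMod 32)) := by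
  decide +kernel

theorem curve_no_solution {n d M e w : ZMod 32} (hn : n ∈ ({5, 13, 21, 29} : Finset (ZMod 32)))
    (hd : d ∈ ({3, 7, 11, 15, 19, 23, 27, 31} : Finset (ZMod 32))) (hMe : M = 1 ∨ e = 1)
    (h : w ^ 2 = d * ((d * M ^ 2) ^ 2 + 2 * n * (d * M ^ 2) * e ^ 2 + -3 * n ^ 2 * (e ^ 2) ^ 2)) :
    False := by
  have key : ∀ v : ZMod 32, v ^ 2 ∈ ({0, 1, 4, 9, 16, 17, 25} : Finset (ZMod 32)) := by
    intro v
    simpa using sq_zmod_thirtytwo v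
  rcases hMe with rfl | rfl
  · refine (curve_no_solution_aux n hn d hd (e ^ 2) (key e)).2 ?_
    have := key w
    rw [h] at this
    simpa using this
  · refine (curve_no_solution_aux n hn d hd (M ^ 2) (key M)).1 ?_
    have := key w
    rw [h] at this
    simpa using this

theorem norm_two_of_squarefree_even {d : ℤ} (hd : Squarefree d) (he : ¬ Odd d) :
    ‖(d : ℚ_[2])‖ = ((2 : ℕ) : ℝ)⁻¹ := by
  have h2 : (2 : ℤ) ∣ d := even_iff_two_dvd.mp (Int.not_odd_iff_even.mp he)
  refine norm_intCast_of_dvd h2 fun h4 => ?_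
  rw [sq] at h4
  have := Int.isUnit_iff.mp (hd _ h4)
  norm_num at this

theorem norm_two_of_odd {d : ℤ} (hd : Odd d) : ‖(d : ℚ_[2])‖ = 1 :=
  norm_intCast_of_not_dvd fun h => Int.not_even_iff_odd.mpr hd (even_iff_two_dvd.mpr h)

/-- `O` and `(0, 0)` give the classes `1` and `5` mod 8. The classes `3` and `7` come from `n` and
`-3n` if `n ≡ 3, 7`, and from `3n` and `-n` if `n ≡ 1`. If `n ≡ 5`, a search modulo 32 shows that
they do not occur. -/
theorem fromCurve_two_iff {n d : ℤ} (hn : Odd n) (hd : Squarefree d) :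
    FromCurve ℚ_[2] n d ↔ Odd d ∧ (n ≡ 5 [ZMOD 8] → d ≡ 1 [ZMOD 4]) := by
  have hn1 := norm_two_of_odd hn
  have hnz : n ≠ 0 := by rintro rfl; simp at hn
  have h3 : ‖(-3 : ℚ_[2])‖ = 1 := by
    have := norm_two_of_odd (d := -3) (by decide)
    exact_mod_cast this
  have hd0 : (d : ℚ_[2]) ≠ 0 := by exact_mod_cast hd.ne_zero
  constructor
  · intro h
    have hodd : Odd d := by
      by_contra he
      have hdn := norm_two_of_squarefree_even hd he
      rcases h with h | h | ⟨x, y, hx, hxy, h⟩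
      · exact not_isSquare_of_norm_eq_inv hdn h
      · exact not_isSquare_of_norm_eq_inv (by rw [norm_mul, h3, hdn, mul_one]) h
      · obtain ⟨z, hz, hxz⟩ := norm_eq_sq_of_equation
          (by have := Padic.norm_int_le_one (p := 2) (2 * n); exact_mod_cast this)
          (by rw [norm_mul, norm_pow, h3, hn1]; norm_num) hx hxy
        exact not_isSquare_mul_of_norm_eq_sq hdn hz hxz h
    refine ⟨hodd, fun hn5 => ?_⟩
    by_contra hd4
    have hd3 : d % 4 = 3 := by
      rw [Int.odd_iff] at hodd; unfold Int.ModEq at hd4; omega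
    -- in all three cases there is an affine point with `x` in the class of `d`
    have hpt : ∃ x y : ℚ_[2], x ≠ 0 ∧ y ^ 2 = x * (x ^ 2 + 2 * n * x + -3 * n ^ 2) ∧
        IsSquare (d * x) := by
      have hn0 : (n : ℚ_[2]) ≠ 0 := by exact_mod_cast hnz
      -- As `-3n ≡ 1 (mod 8)`, the points `(-3n, 0)` and `(n, 0)` have the classes of `O` and `(0,
      -- 0)` and can replace them.
      have h15 : IsSquare (-3 * (n : ℚ_[2])) := by
        have := isSquare_two_mul (d := -3) (c := n) (by unfold Int.ModEq at hn5; omega)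
        exact_mod_cast this
      rcases h with h | h | h
      · exact ⟨-3 * n, 0, mul_ne_zero (by norm_num) hn0, by ring, h.mul h15⟩
      · exact ⟨n, 0, hn0, by ring, isSquare_mul_trans (by norm_num) h h15⟩
      · exact h
    obtain ⟨x, y, hx, hxy, h⟩ := hpt
    obtain ⟨M, e, w, hMe, hw⟩ := exists_homogeneous (d := d) (a := 2 * n) (b := -3 * n ^ 2)
      (by rwa [PadicInt.coe_intCast]) hx (by push_cast; exact hxy) (by exact_mod_cast h)
    have hw' := congrArg (PadicInt.toZModPow 5) hw
    simp only [map_pow, map_mul, map_add, map_neg, map_ofNat, map_intCast] at hw'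
    refine curve_no_solution (n := (n : ZMod 32)) (d := (d : ZMod 32)) ?_ ?_ ?_ hw'
    · have : n % 32 = 5 ∨ n % 32 = 13 ∨ n % 32 = 21 ∨ n % 32 = 29 := by
        unfold Int.ModEq at hn5; omega
      rw [← ZMod.intCast_mod n 32]
      rcases this with h | h | h | h <;> simp only [Nat.cast_ofNat, h] <;> decide
    · have : d % 32 = 3 ∨ d % 32 = 7 ∨ d % 32 = 11 ∨ d % 32 = 15 ∨ d % 32 = 19 ∨ d % 32 = 23 ∨
          d % 32 = 27 ∨ d % 32 = 31 := by omega
      rw [← ZMod.intCast_mod d 32]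
      rcases this with h | h | h | h | h | h | h | h <;> simp only [Nat.cast_ofNat, h] <;> decide
    · rcases hMe with rfl | rfl
      · exact Or.inl (map_one _)
      · exact Or.inr (map_one _)
  · rintro ⟨hodd, hd4⟩
    rw [Int.odd_iff] at hodd hn
    have hcase : d % 8 = 1 ∨ d % 8 = 5 ∨ (d % 8 = 3 ∨ d % 8 = 7) ∧ n % 8 ≠ 5 := by
      unfold Int.ModEq at hd4; omega
    rcases hcase with h | h | ⟨h, hn5⟩
    · exact Or.inl (isSquare_two_of_modEq h)
    · refine Or.inr (Or.inl ?_)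
      have := isSquare_two_mul (d := d) (c := -3) (by omega)
      exact_mod_cast this
    · have hn8 : n % 8 = 1 ∨ n % 8 = 3 ∨ n % 8 = 7 := by omega
      have hself : d * n % 8 = 1 → FromCurve ℚ_[2] n d := fun h =>
        fromCurve_self hnz (isSquare_two_mul h)
      have hneg : d * (-3 * n) % 8 = 1 → FromCurve ℚ_[2] n d := fun h =>
        fromCurve_neg_three_mul hnz (by exact_mod_cast isSquare_two_mul h)
      rcases hn8 with hn8 | hn8 | hn8
      · have hsq := isSquare_two_of_modEq hn8
        refine fromCurve_of_isSquare hnz hsq ?_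
        rcases h with h | h
        · exact Or.inr (by exact_mod_cast isSquare_two_mul (d := d) (c := 3) (by omega))
        · exact Or.inl (by exact_mod_cast isSquare_two_mul (d := d) (c := -1) (by omega))
      · rcases h with h | h
        · exact hself (by rw [Int.mul_emod, h, hn8]; norm_num)
        · exact hneg (by rw [Int.mul_emod, Int.mul_emod (-3), h, hn8]; norm_num)
      · rcases h with h | h
        · exact hneg (by rw [Int.mul_emod, Int.mul_emod (-3), h, hn8]; norm_num)
        · exact hself (by rw [Int.mul_emod, h, hn8]; norm_num)

theorem fromIsogenous_two_of_values {n d X : ℤ} (hX : X ≠ 0)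
    (hy : IsSquare ((X * (X ^ 2 - n * X + n ^ 2) : ℤ) : ℚ_[2]))
    (hd : IsSquare ((d : ℚ_[2]) * X)) : FromIsogenous ℚ_[2] n d := by
  obtain ⟨y, hy⟩ := hy
  refine Or.inr ⟨X, y, by exact_mod_cast hX, ?_, hd⟩
  rw [sq, ← hy]
  push_cast
  ring

theorem fromIsogenous_two_iff {n d : ℤ} (hn : Odd n) (hd : Squarefree d) :
    FromIsogenous ℚ_[2] n d ↔ Odd d ∧ (¬ n ≡ 5 [ZMOD 8] → d ≡ 1 [ZMOD 4]) := by
  have hn1 := norm_two_of_odd hn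
  have hd0 : (d : ℚ_[2]) ≠ 0 := by exact_mod_cast hd.ne_zero
  constructor
  · intro h
    have hodd : Odd d := by
      by_contra he
      have hdn := norm_two_of_squarefree_even hd he
      rcases h with h | ⟨x, y, hx, hxy, h⟩
      · exact not_isSquare_of_norm_eq_inv hdn h
      · obtain ⟨z, hz, hxz⟩ := norm_eq_sq_of_equation
          (by rw [norm_neg]; exact Padic.norm_int_le_one n)
          (by rw [norm_pow, hn1, one_pow]) hx hxy
        exact not_isSquare_mul_of_norm_eq_sq hdn hz hxz h
    refine ⟨hodd, fun hn5 => ?_⟩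
    rcases h with h | ⟨x, y, hx, hxy, h⟩
    · exact modEq_of_isSquare_two hodd h
    by_contra hd4
    obtain ⟨M, e, w, hMe, hw⟩ := exists_homogeneous (d := d) (a := -n) (b := n ^ 2)
      (by rwa [PadicInt.coe_intCast]) hx (by push_cast; exact hxy) (by exact_mod_cast h)
    have hw' := congrArg (PadicInt.toZModPow 3) hw
    simp only [map_pow, map_mul, map_add, map_neg, map_intCast] at hw'
    refine isogenous_no_solution (n := (n : ZMod 8)) (d := (d : ZMod 8)) ?_ ?_ ?_ hw'
    · have : n % 8 = 1 ∨ n % 8 = 3 ∨ n % 8 = 7 := by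
        rw [Int.odd_iff] at hn; unfold Int.ModEq at hn5; omega
      rw [← ZMod.intCast_mod n 8]
      rcases this with h | h | h <;> simp only [Nat.cast_ofNat, h] <;> decide
    · have : d % 8 = 3 ∨ d % 8 = 7 := by
        rw [Int.odd_iff] at hodd; unfold Int.ModEq at hd4; omega
      rw [← ZMod.intCast_mod d 8]
      rcases this with h | h <;> simp only [Nat.cast_ofNat, h] <;> decide
    · rcases hMe with rfl | rfl
      · exact Or.inl (map_one _)
      · exact Or.inr (map_one _)
  · rintro ⟨hodd, hd4⟩
    rw [Int.odd_iff] at hodd hn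
    have hcase : d % 8 = 1 ∨ d % 8 = 5 ∨ (d % 8 = 3 ∨ d % 8 = 7) ∧ n % 8 = 5 := by
      unfold Int.ModEq at hd4; omega
    rcases hcase with h | h | ⟨h | h, hn5⟩
    · exact Or.inl (isSquare_two_of_modEq h)
    -- `20` has the class of `5`, and `5 (400 - 20n + n²) ≡ 5 (1 - 4) ≡ 1 (mod 8)` for every odd
    -- `n`.
    · refine fromIsogenous_two_of_values (X := 20) (by norm_num) ?_ ?_
      · have h1 : n * n % 8 = 1 := by
          have : n % 8 = 1 ∨ n % 8 = 3 ∨ n % 8 = 5 ∨ n % 8 = 7 := by omega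
          rcases this with h | h | h | h <;> rw [Int.mul_emod, h] <;> norm_num
        have := isSquare_two_of_modEq (a := 5 * (400 - 20 * n + n * n))
          (by unfold Int.ModEq; omega)
        have e : ((20 * (20 ^ 2 - n * 20 + n ^ 2) : ℤ) : ℚ_[2]) =
            2 * 2 * ((5 * (400 - 20 * n + n * n) : ℤ) : ℚ_[2]) := by push_cast; ring
        rw [e]
        exact IsSquare.mul ⟨2, rfl⟩ this
      · have := isSquare_two_mul (d := d) (c := 5) (by omega)
        have e : (d : ℚ_[2]) * (20 : ℤ) = 2 * 2 * (d * (5 : ℤ)) := by push_cast; ring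
        rw [e]
        exact IsSquare.mul ⟨2, rfl⟩ this
    · have h1 : n * n % 8 = 1 := by rw [Int.mul_emod, hn5]; norm_num
      -- For `n ≡ 5 (mod 8)` the cubic is `≡ 1 (mod 8)` at `X = 3` and at `X = -1`.
      refine fromIsogenous_two_of_values (X := 3) (by norm_num) ?_
        (isSquare_two_mul (by omega))
      refine isSquare_two_of_modEq ?_
      rw [sq n]; unfold Int.ModEq; omega
    · have h1 : n * n % 8 = 1 := by rw [Int.mul_emod, hn5]; norm_num
      refine fromIsogenous_two_of_values (X := -1) (by norm_num) ?_
        (isSquare_two_mul (by omega))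
      refine isSquare_two_of_modEq ?_
      rw [sq n]; unfold Int.ModEq; omega

end Two

/-! ### Square classes as subsets under symmetric difference -/

theorem prod_symmDiff_mul_sq {α M : Type*} [DecidableEq α] [CommMonoid M] (f : α → M)
    (s t : Finset α) :
    (∏ v ∈ symmDiff s t, f v) * ((∏ v ∈ s ∩ t, f v) * ∏ v ∈ s ∩ t, f v) =
      (∏ v ∈ s, f v) * ∏ v ∈ t, f v := by
  have hd : Disjoint (s \ t) (t \ s) := disjoint_sdiff_sdiff
  have h : symmDiff s t = (s \ t).disjUnion (t \ s) hd := by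
    rw [Finset.disjUnion_eq_union]; rfl
  rw [h, Finset.prod_disjUnion, ← Finset.prod_inter_mul_prod_sdiff s t f,
    ← Finset.prod_inter_mul_prod_sdiff t s f, Finset.inter_comm t s]
  simp only [mul_assoc, mul_comm, mul_left_comm]

theorem dProd_mul (s t : Finset ℤ) :
    dProd s * dProd t = dProd (symmDiff s t) * (dProd (s ∩ t) * dProd (s ∩ t)) :=
  (prod_symmDiff_mul_sq (fun v => v) s t).symm

/-- Sets consisting of `-1` and (positive) primes. -/
def IsVertexSet (V : Finset ℤ) : Prop :=
  ∀ v ∈ V, v = -1 ∨ ∃ q : ℕ, q.Prime ∧ v = q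

theorem IsVertexSet.mono {V W : Finset ℤ} (hV : IsVertexSet V) (h : W ⊆ V) : IsVertexSet W :=
  fun v hv => hV v (h hv)

theorem IsVertexSet.dvd_iff {V : Finset ℤ} (hV : IsVertexSet V) {q : ℕ} (hq : q.Prime) {v : ℤ}
    (hv : v ∈ V) : (q : ℤ) ∣ v ↔ v = q := by
  constructor
  · intro h
    rcases hV v hv with rfl | ⟨r, hr, rfl⟩
    · exact absurd (Int.natCast_dvd.mp h) (by simpa using hq.one_lt.ne')
    · rw [(Nat.prime_dvd_prime_iff_eq hq hr).mp (Int.natCast_dvd_natCast.mp h)]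
  · rintro rfl; exact dvd_rfl

theorem IsVertexSet.dvd_dProd_iff {V : Finset ℤ} (hV : IsVertexSet V) {q : ℕ} (hq : q.Prime) :
    (q : ℤ) ∣ dProd V ↔ (q : ℤ) ∈ V := by
  rw [dProd, (Nat.prime_iff_prime_int.mp hq).dvd_finsetProd_iff]
  constructor
  · rintro ⟨v, hv, h⟩
    rwa [← (hV.dvd_iff hq hv).mp h]
  · intro h; exact ⟨_, h, dvd_rfl⟩

theorem IsVertexSet.dProd_ne_zero {V : Finset ℤ} (hV : IsVertexSet V) : dProd V ≠ 0 := by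
  rw [dProd, Finset.prod_ne_zero_iff]
  intro v hv
  rcases hV v hv with rfl | ⟨r, hr, rfl⟩
  · norm_num
  · exact_mod_cast hr.ne_zero

theorem IsVertexSet.sq_not_dvd {V : Finset ℤ} (hV : IsVertexSet V) {q : ℕ} (hq : q.Prime) :
    ¬ (q : ℤ) ^ 2 ∣ dProd V := by
  intro h
  have hmem : (q : ℤ) ∈ V := (hV.dvd_dProd_iff hq).mp ((dvd_pow_self _ two_ne_zero).trans h)
  have e : dProd V = q * dProd (V.erase q) := (Finset.mul_prod_erase V (fun v => v) hmem).symm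
  rw [e, sq] at h
  have := Int.dvd_of_mul_dvd_mul_left (by exact_mod_cast hq.ne_zero) h
  rw [(hV.mono (Finset.erase_subset _ _)).dvd_dProd_iff hq] at this
  simp at this

theorem IsVertexSet.squarefree_dProd {V : Finset ℤ} (hV : IsVertexSet V) :
    Squarefree (dProd V) := by
  rw [← Int.squarefree_natAbs, Nat.squarefree_iff_prime_squarefree]
  intro q hq h
  refine hV.sq_not_dvd hq ?_
  rw [sq]
  exact_mod_cast Int.natCast_dvd.mpr h

theorem IsVertexSet.eq_empty_of_isSquare {V : Finset ℤ} (hV : IsVertexSet V)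
    (h : IsSquare (dProd V)) : V = ∅ := by
  obtain ⟨z, hz⟩ := h
  have hu : IsUnit z := hV.squarefree_dProd z ⟨1, by rw [hz, mul_one]⟩
  have h1 : dProd V = 1 := by
    rcases Int.isUnit_iff.mp hu with rfl | rfl <;> simpa using hz
  have hsub : ∀ v ∈ V, v = -1 := by
    intro v hv
    rcases hV v hv with h | ⟨q, hq, rfl⟩
    · exact h
    · have := (hV.dvd_dProd_iff hq).mpr hv
      rw [h1] at this
      exact absurd (Int.natCast_dvd.mp this) (by simpa using hq.one_lt.ne')
  by_contra hne
  obtain ⟨v, hv⟩ := Finset.nonempty_iff_ne_empty.mpr hne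
  have : V = {-1} := Finset.eq_singleton_iff_unique_mem.mpr ⟨hsub v hv ▸ hv, hsub⟩
  rw [this] at h1
  simp [dProd] at h1

/-- Equal classes make `d(W₁ ∆ W₂)` a square. Being square-free it is then `1`, which leaves only
the empty set. -/
theorem sqClass_dProd_injOn {U : Finset ℤ} (hU : IsVertexSet U) {W₁ W₂ : Finset ℤ} (h₁ : W₁ ⊆ U)
    (h₂ : W₂ ⊆ U) (h : sqClass (dProd W₁ : ℚ) = sqClass (dProd W₂ : ℚ)) : W₁ = W₂ := by
  have e₁ := (hU.mono h₁).dProd_ne_zero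
  have e₂ := (hU.mono h₂).dProd_ne_zero
  rw [sqClass_eq_iff (by exact_mod_cast e₁) (by exact_mod_cast e₂), ← Int.cast_mul,
    Rat.isSquare_intCast_iff, dProd_mul] at h
  have hi : dProd (W₁ ∩ W₂) ≠ 0 :=
    (hU.mono (Finset.inter_subset_left.trans h₁)).dProd_ne_zero
  have hs : IsSquare (dProd (symmDiff W₁ W₂)) := by
    obtain ⟨z, hz⟩ := h
    have : dProd (W₁ ∩ W₂) ∣ z := by
      have hd : dProd (W₁ ∩ W₂) ^ 2 ∣ z ^ 2 := ⟨dProd (symmDiff W₁ W₂), by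
        rw [sq z, ← hz]; ring⟩
      exact (Int.pow_dvd_pow_iff two_ne_zero).mp hd
    obtain ⟨w, rfl⟩ := this
    refine ⟨w, mul_right_cancel₀ (mul_ne_zero hi hi) ?_⟩
    rw [hz]; ring
  have hsub : symmDiff W₁ W₂ ⊆ U := by
    intro v hv
    rcases Finset.mem_symmDiff.mp hv with h | h
    · exact h₁ h.1
    · exact h₂ h.1
  exact symmDiff_eq_bot.mp ((hU.mono hsub).eq_empty_of_isSquare hs)

theorem mem_closure_iff_exists_dProd {U : Finset ℤ} (hU : IsVertexSet U) (c : SqClass ℚ) :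
    c ∈ Subgroup.closure {c : SqClass ℚ | ∃ v ∈ U, c = sqClass (v : ℚ)} ↔
      ∃ W ⊆ U, c = sqClass (dProd W : ℚ) := by
  constructor
  · intro hc
    induction hc using Subgroup.closure_induction with
    | mem x hx =>
      obtain ⟨v, hv, rfl⟩ := hx
      exact ⟨{v}, Finset.singleton_subset_iff.mpr hv, by simp [dProd]⟩
    | one => exact ⟨∅, Finset.empty_subset _, by simp [dProd, sqClass_one]⟩
    | mul x y _ _ hx hy =>
      obtain ⟨W₁, h₁, rfl⟩ := hx
      obtain ⟨W₂, h₂, rfl⟩ := hy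
      have hs : symmDiff W₁ W₂ ⊆ U := by
        intro v hv
        rcases Finset.mem_symmDiff.mp hv with h | h
        · exact h₁ h.1
        · exact h₂ h.1
      have e₁ : (dProd W₁ : ℚ) ≠ 0 := by exact_mod_cast (hU.mono h₁).dProd_ne_zero
      have e₂ : (dProd W₂ : ℚ) ≠ 0 := by exact_mod_cast (hU.mono h₂).dProd_ne_zero
      have e₃ : (dProd (symmDiff W₁ W₂) : ℚ) ≠ 0 := by exact_mod_cast (hU.mono hs).dProd_ne_zero
      refine ⟨_, hs, ?_⟩
      rw [← sqClass_mul e₁ e₂, sqClass_eq_iff (mul_ne_zero e₁ e₂) e₃]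
      refine ⟨dProd (symmDiff W₁ W₂) * dProd (W₁ ∩ W₂), ?_⟩
      rw [← Int.cast_mul, dProd_mul]
      push_cast
      ring
    | inv x _ hx =>
      obtain ⟨W, h, rfl⟩ := hx
      have e : (dProd W : ℚ) ≠ 0 := by exact_mod_cast (hU.mono h).dProd_ne_zero
      refine ⟨W, h, inv_eq_of_mul_eq_one_left ?_⟩
      rw [← sqClass_mul e e, ← sqClass_one, sqClass_eq_iff (mul_ne_zero e e) one_ne_zero, mul_one]
      exact ⟨_, rfl⟩
  · rintro ⟨W, hW, rfl⟩
    induction W using Finset.induction_on with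
    | empty => simp [dProd, sqClass_one, one_mem]
    | insert v W hv ih =>
      have hW' := (Finset.subset_insert v W).trans hW
      have e : dProd (insert v W) = v * dProd W := Finset.prod_insert hv
      have hvU := hW (Finset.mem_insert_self v W)
      have e₀ := (hU.mono hW).dProd_ne_zero
      have e₁ := (hU.mono hW').dProd_ne_zero
      have ev : v ≠ 0 := by rintro rfl; simp [e] at e₀
      rw [e, Int.cast_mul, sqClass_mul (by exact_mod_cast ev) (by exact_mod_cast e₁)]
      exact mul_mem (Subgroup.subset_closure ⟨v, hvU, rfl⟩) (ih hW')

/-- The subsets on which finitely many `±1`-valued characters are trivial are at least as many as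
the dimension count predicts. -/
theorem two_pow_card_le_card_ker {α ι : Type*} [DecidableEq α] [Fintype ι] [DecidableEq ι]
    (V : Finset α) (a : ι → α → ℤ) (ha : ∀ i, ∀ v ∈ V, a i v = 1 ∨ a i v = -1) :
    2 ^ V.card ≤
      (V.powerset.filter fun W => ∀ i, ∏ v ∈ W, a i v = 1).card * 2 ^ Fintype.card ι := by
  have hprod : ∀ i, ∀ W ⊆ V, ∏ v ∈ W, a i v = 1 ∨ ∏ v ∈ W, a i v = -1 := by
    intro i W hW
    refine Finset.prod_induction _ (fun x : ℤ => x = 1 ∨ x = -1) ?_ (Or.inl rfl)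
      fun v hv => ha i v (hW hv)
    rintro x y (rfl | rfl) (rfl | rfl) <;> simp
  let f : Finset α → ι → ℤ := fun W i => ∏ v ∈ W, a i v
  let T : Finset (ι → ℤ) := Fintype.piFinset fun _ => ({1, -1} : Finset ℤ)
  have hT : T.card = 2 ^ Fintype.card ι := by simp [T]
  rw [← Finset.card_powerset, ← hT]
  refine Finset.card_le_mul_card_image_of_maps_to (f := f) ?_ _ ?_
  · intro W hW
    rw [Fintype.mem_piFinset]
    intro i
    simpa [f] using hprod i W (Finset.mem_powerset.mp hW)
  · intro b _
    rcases (V.powerset.filter fun W => f W = b).eq_empty_or_nonempty with h | ⟨W₀, hW₀⟩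
    · rw [h]; simp
    rw [Finset.mem_filter, Finset.mem_powerset] at hW₀
    -- Translation by a fixed member embeds each non-empty fibre of `f` into the kernel, and `f`
    -- takes at most `2 ^ |ι|` values.
    refine Finset.card_le_card_of_injOn (fun W => symmDiff W W₀) ?_ ?_
    · intro W hW
      rw [Finset.mem_coe, Finset.mem_filter, Finset.mem_powerset] at hW
      rw [Finset.mem_coe, Finset.mem_filter, Finset.mem_powerset]
      refine ⟨fun v hv => ?_, fun i => ?_⟩
      · rcases Finset.mem_symmDiff.mp hv with h | h
        · exact hW.1 h.1
        · exact hW₀.1 h.1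
      · have h1 := prod_symmDiff_mul_sq (a i) W W₀
        have h2 : ∏ v ∈ W, a i v = ∏ v ∈ W₀, a i v := congrFun (hW.2.trans hW₀.2.symm) i
        rw [h2] at h1
        rcases hprod i _ (Finset.inter_subset_left.trans hW.1 : W ∩ W₀ ⊆ V) with h | h <;>
          rcases hprod i _ hW₀.1 with h' | h' <;> rw [h, h'] at h1 <;> simpa using h1
    · intro W _ W' _ h
      exact symmDiff_left_injective W₀ h

/-! ### Legendre characters on vertex sets -/

section Characters

variable {V : Finset ℤ} {q : ℕ} [hq : Fact q.Prime]

/-- The `±1`-valued character on vertices that computes, by multiplicativity, whether `d(W)` is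
trivial in `ℚ_qˣ` modulo squares and `d(V)`. -/
def vertexChar (V : Finset ℤ) (q : ℕ) [Fact q.Prime] (v : ℤ) : ℤ :=
  if v = q then legendreSym q (dProd (V.erase q)) else legendreSym q v

theorem legendreSym_dProd (W : Finset ℤ) :
    legendreSym q (dProd W) = ∏ v ∈ W, legendreSym q v :=
  map_prod (legendreSym.hom q) _ _

theorem IsVertexSet.legendreSym_dProd_eq (hV : IsVertexSet V) (h : (q : ℤ) ∉ V) :
    legendreSym q (dProd V) = 1 ∨ legendreSym q (dProd V) = -1 := by
  apply legendreSym.eq_one_or_neg_one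
  rwa [Ne, ZMod.intCast_zmod_eq_zero_iff_dvd, hV.dvd_dProd_iff hq.out]

theorem IsVertexSet.vertexChar_eq (hV : IsVertexSet V) {v : ℤ} (hv : v ∈ V) :
    vertexChar V q v = 1 ∨ vertexChar V q v = -1 := by
  unfold vertexChar
  split_ifs with h
  · exact (hV.mono (Finset.erase_subset _ _)).legendreSym_dProd_eq (by simp)
  · apply legendreSym.eq_one_or_neg_one
    rwa [Ne, ZMod.intCast_zmod_eq_zero_iff_dvd, hV.dvd_iff hq.out hv]

theorem prod_vertexChar_of_notMem {W : Finset ℤ} (h : (q : ℤ) ∉ W) :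
    ∏ v ∈ W, vertexChar V q v = legendreSym q (dProd W) := by
  rw [legendreSym_dProd]
  refine Finset.prod_congr rfl fun v hv => if_neg ?_
  rintro rfl; exact h hv

/-- The value of the character at `q` is the symbol of `d(V \ W) d(W \ {q})`. The other vertices of
`W` contribute the second factor again, which cancels it. -/
theorem IsVertexSet.prod_vertexChar_of_mem (hV : IsVertexSet V) {W : Finset ℤ} (hW : W ⊆ V)
    (h : (q : ℤ) ∈ W) : ∏ v ∈ W, vertexChar V q v = legendreSym q (dProd (V \ W)) := by
  have hsub : W.erase q ⊆ V := (Finset.erase_subset _ _).trans hW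
  rw [← Finset.mul_prod_erase W _ h, prod_vertexChar_of_notMem (by simp), vertexChar, if_pos rfl]
  have e : dProd (V.erase q) = dProd (V \ W) * dProd (W.erase q) := by
    have : V.erase (q : ℤ) \ W.erase q = V \ W := by
      ext v; simp only [Finset.mem_sdiff, Finset.mem_erase]
      constructor
      · rintro ⟨⟨h1, h2⟩, h3⟩; exact ⟨h2, fun h4 => h3 ⟨h1, h4⟩⟩
      · rintro ⟨h1, h2⟩
        exact ⟨⟨fun h3 => h2 (h3 ▸ h), h1⟩, fun h3 => h2 h3.2⟩
    rw [← this]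
    exact (Finset.prod_sdiff (f := fun v => v) (Finset.erase_subset_erase _ hW)).symm
  rw [e, legendreSym.mul, mul_assoc]
  rcases (hV.mono hsub).legendreSym_dProd_eq (q := q) (by simp) with h | h <;> rw [h] <;> simp

/-- Since `q` divides `d(V)` exactly once, one of `d(W)` and `d(W) d(V)` has odd valuation. The
other is, up to squares, the unit `d(W)` if `q ∉ W` and `d(V \ W)` if `q ∈ W`. -/
theorem IsVertexSet.prod_vertexChar_eq_one_iff (hV : IsVertexSet V) (h2 : q ≠ 2)
    (hqV : (q : ℤ) ∈ V) {W : Finset ℤ} (hW : W ⊆ V) :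
    ∏ v ∈ W, vertexChar V q v = 1 ↔
      IsSquare (dProd W : ℚ_[q]) ∨ IsSquare ((dProd W : ℚ_[q]) * dProd V) := by
  have hnorm : ∀ S ⊆ V, (q : ℤ) ∈ S → ‖(dProd S : ℚ_[q])‖ = (q : ℝ)⁻¹ := fun S hS h =>
    norm_intCast_of_dvd (((hV.mono hS).dvd_dProd_iff hq.out).mpr h)
      ((hV.mono hS).sq_not_dvd hq.out)
  by_cases h : (q : ℤ) ∈ W
  · have e : dProd V = dProd (V \ W) * dProd W :=
      (Finset.prod_sdiff (f := fun v => v) hW).symm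
    have e0 : (dProd W : ℚ_[q]) ≠ 0 := by exact_mod_cast (hV.mono hW).dProd_ne_zero
    have e' : (dProd W : ℚ_[q]) * dProd V = dProd W * dProd W * dProd (V \ W) := by
      rw [e]; push_cast; ring
    rw [hV.prod_vertexChar_of_mem hW h, or_iff_right (not_isSquare_of_norm_eq_inv (hnorm W hW h)),
      e', isSquare_mul_left_iff ⟨_, rfl⟩ (mul_ne_zero e0 e0), isSquare_intCast_iff h2]
    rw [(hV.mono Finset.sdiff_subset).dvd_dProd_iff hq.out]
    simp [h]
  · have hnd : ¬ (q : ℤ) ∣ dProd W := by rwa [(hV.mono hW).dvd_dProd_iff hq.out]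
    have hns : ¬ IsSquare ((dProd W : ℚ_[q]) * dProd V) := by
      apply not_isSquare_of_norm_eq_inv
      rw [norm_mul, norm_intCast_of_not_dvd hnd, hnorm V subset_rfl hqV, one_mul]
    rw [prod_vertexChar_of_notMem h, or_iff_left hns, isSquare_intCast_iff h2 hnd]

theorem IsVertexSet.prod_vertexChar_eq (hV : IsVertexSet V) {W : Finset ℤ} (hW : W ⊆ V) :
    ∏ v ∈ W, vertexChar V q v = 1 ∨ ∏ v ∈ W, vertexChar V q v = -1 := by
  refine Finset.prod_induction _ (fun x : ℤ => x = 1 ∨ x = -1) ?_ (Or.inl rfl)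
    fun v hv => hV.vertexChar_eq (hW hv)
  rintro x y (rfl | rfl) (rfl | rfl) <;> simp

end Characters

/-! ### Odd partitions in terms of characters -/

section Graph

theorem graphG_adj_iff {m : ℤ} {q : ℕ} [hq : Fact q.Prime] {w : ℤ} :
    (graphG m).Adj q w ↔ (q : ℤ) ∈ graphVertices m ∧ w ∈ graphVertices m ∧ q ≡ 1 [MOD 3] ∧
      legendreSym q w = -1 := by
  refine and_congr Iff.rfl (and_congr Iff.rfl ?_)
  constructor
  · rintro ⟨r, hr, h1, h2, h3⟩
    obtain rfl : q = r := by exact_mod_cast h1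
    exact ⟨h2, h3⟩
  · rintro ⟨h2, h3⟩
    exact ⟨q, hq, rfl, h2, h3⟩

/-- The symbol of `d(W)` at `v` is `-1` to the number of arcs. As `v ∉ W`, no factor vanishes.
Vertices other than primes `≡ 1 (mod 3)` emit no arcs. -/
theorem odd_arcsInto_iff {m : ℤ} (hV : IsVertexSet (graphVertices m)) {v : ℤ} {W : Finset ℤ}
    (hv : v ∈ graphVertices m) (hW : W ⊆ graphVertices m) (hvW : v ∉ W) :
    Odd (arcsInto (graphG m) v W) ↔
      ∃ (q : ℕ) (_ : Fact q.Prime), v = q ∧ q ≡ 1 [MOD 3] ∧ legendreSym q (dProd W) = -1 := by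
  classical
  have key : ∀ (q : ℕ) (_ : Fact q.Prime), v = q → q ≡ 1 [MOD 3] →
      (Odd (arcsInto (graphG m) v W) ↔ legendreSym q (dProd W) = -1) := by
    rintro q hq rfl h1
    have e : arcsInto (graphG m) q W = (W.filter fun w => legendreSym q w = -1).card := by
      unfold arcsInto
      congr 1
      ext w
      simp only [Finset.mem_filter, graphG_adj_iff]
      exact ⟨fun h => ⟨h.1, h.2.2.2.2⟩, fun h => ⟨h.1, hv, hW h.1, h1, h.2⟩⟩
    have hprod : legendreSym q (dProd W) =
        (-1) ^ (W.filter fun w => legendreSym q w = -1).card := by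
      rw [legendreSym_dProd, ← Finset.prod_filter_mul_prod_filter_not W
        (fun w => legendreSym q w = -1)]
      rw [Finset.prod_congr rfl (fun w hw => (Finset.mem_filter.mp hw).2), Finset.prod_const,
        Finset.prod_eq_one, mul_one]
      intro w hw
      rw [Finset.mem_filter] at hw
      refine (legendreSym.eq_one_or_neg_one q ?_).resolve_right hw.2
      rw [Ne, ZMod.intCast_zmod_eq_zero_iff_dvd, hV.dvd_iff hq.out (hW hw.1)]
      rintro rfl; exact hvW hw.1
    rw [e, hprod]
    constructor
    · intro h; exact h.neg_one_pow
    · intro h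
      by_contra hne
      rw [(Nat.not_odd_iff_even.mp hne).neg_one_pow] at h
      norm_num at h
  constructor
  · intro h
    have hne : arcsInto (graphG m) v W ≠ 0 := by rintro h0; rw [h0] at h; simp at h
    obtain ⟨w, hw⟩ := Finset.card_ne_zero.mp hne
    obtain ⟨-, -, -, q, hq, hvq, h1, -⟩ := Finset.mem_filter.mp hw
    exact ⟨q, hq, hvq, h1, (key q hq hvq h1).mp h⟩
  · rintro ⟨q, hq, hvq, h1, h⟩
    exact (key q hq hvq h1).mpr h

theorem oddIn_iff {m : ℤ} (hV : IsVertexSet (graphVertices m)) {W : Finset ℤ}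
    (hW : W ⊆ graphVertices m) :
    OddIn m W ↔ ∃ (q : ℕ) (_ : Fact q.Prime), (q : ℤ) ∈ graphVertices m ∧ q ≡ 1 [MOD 3] ∧
      ∏ v ∈ W, vertexChar (graphVertices m) q v = -1 := by
  constructor
  · rintro (⟨v, hv, h⟩ | ⟨v, hv, h⟩)
    · obtain ⟨q, hq, rfl, h1, h⟩ := (odd_arcsInto_iff hV (hW hv) Finset.sdiff_subset
        (by simp [hv])).mp h
      exact ⟨q, hq, hW hv, h1, by rwa [hV.prod_vertexChar_of_mem hW hv]⟩
    · rw [Finset.mem_sdiff] at hv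
      obtain ⟨q, hq, rfl, h1, h⟩ := (odd_arcsInto_iff hV hv.1 hW hv.2).mp h
      exact ⟨q, hq, hv.1, h1, by rwa [prod_vertexChar_of_notMem hv.2]⟩
  · rintro ⟨q, hq, hqV, h1, h⟩
    by_cases hqW : (q : ℤ) ∈ W
    · left
      refine ⟨q, hqW, (odd_arcsInto_iff hV hqV Finset.sdiff_subset (by simp [hqW])).mpr ?_⟩
      exact ⟨q, hq, rfl, h1, by rwa [← hV.prod_vertexChar_of_mem hW hqW]⟩
    · right
      refine ⟨q, Finset.mem_sdiff.mpr ⟨hqV, hqW⟩, (odd_arcsInto_iff hV hqV hW hqW).mpr ?_⟩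
      exact ⟨q, hq, rfl, h1, by rwa [← prod_vertexChar_of_notMem (V := graphVertices m) hqW]⟩

/-- A partition is even exactly if `d(W)` is locally a square up to `d(V)` at all primes
`q ≡ 1 (mod 3)` of the graph. -/
theorem not_oddIn_iff {m : ℤ} (hV : IsVertexSet (graphVertices m))
    (h2 : (2 : ℤ) ∉ graphVertices m) {W : Finset ℤ} (hW : W ⊆ graphVertices m) :
    ¬ OddIn m W ↔ ∀ (q : ℕ) [Fact q.Prime], (q : ℤ) ∈ graphVertices m → q ≡ 1 [MOD 3] →
      IsSquare (dProd W : ℚ_[q]) ∨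
        IsSquare ((dProd W : ℚ_[q]) * dProd (graphVertices m)) := by
  rw [oddIn_iff hV hW]
  push Not
  refine forall_congr' fun q => forall_congr' fun hq => forall_congr' fun hqV =>
    forall_congr' fun h1 => ?_
  have hq2 : q ≠ 2 := by rintro rfl; exact h2 hqV
  rw [← hV.prod_vertexChar_eq_one_iff hq2 hqV hW]
  rcases hV.prod_vertexChar_eq (q := q) hW with h | h <;> rw [h] <;> norm_num

end Graph

/-! ### Selmer classes as even partitions -/

/-- Sets of primes `≥ 5`. -/
def IsPrimeSet (P : Finset ℤ) : Prop :=
  ∀ v ∈ P, ∃ q : ℕ, q.Prime ∧ 5 ≤ q ∧ v = q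

theorem mem_graphVertices_of_neg {m : ℤ} (hm : m < 0) {v : ℤ} :
    v ∈ graphVertices m ↔ v = -1 ∨ ∃ q : ℕ, q.Prime ∧ (q : ℤ) ∣ m ∧ v = q := by
  simp only [graphVertices, if_pos hm, Finset.mem_union, Finset.mem_singleton, Finset.mem_image,
    Nat.mem_primeFactors, Int.natCast_dvd]
  refine or_congr Iff.rfl (exists_congr fun q => ?_)
  constructor
  · rintro ⟨⟨h1, h2, -⟩, rfl⟩; exact ⟨h1, h2, rfl⟩
  · rintro ⟨h1, h2, rfl⟩; exact ⟨⟨h1, h2, by simpa using hm.ne⟩, rfl⟩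

theorem isVertexSet_graphVertices_of_neg {m : ℤ} (hm : m < 0) :
    IsVertexSet (graphVertices m) := by
  intro v hv
  rcases (mem_graphVertices_of_neg hm).mp hv with h | ⟨q, hq, -, rfl⟩
  · exact Or.inl h
  · exact Or.inr ⟨q, hq, rfl⟩

namespace IsPrimeSet

variable {P : Finset ℤ}

theorem isVertexSet (hP : IsPrimeSet P) : IsVertexSet P := fun v hv => by
  obtain ⟨q, hq, -, h⟩ := hP v hv
  exact Or.inr ⟨q, hq, h⟩

theorem five_le (hP : IsPrimeSet P) {v : ℤ} (hv : v ∈ P) : 5 ≤ v := by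
  obtain ⟨q, -, h5, rfl⟩ := hP v hv
  exact_mod_cast h5

theorem dProd_pos (hP : IsPrimeSet P) {W : Finset ℤ} (hW : W ⊆ P) : 0 < dProd W :=
  Finset.prod_pos fun v hv => by have := hP.five_le (hW hv); omega

theorem prime_dvd_dProd_iff (hP : IsPrimeSet P) {q : ℕ} (hq : q.Prime) :
    (q : ℤ) ∣ dProd P ↔ (q : ℤ) ∈ P := hP.isVertexSet.dvd_dProd_iff hq

theorem not_two_dvd (hP : IsPrimeSet P) : ¬ (2 : ℤ) ∣ dProd P := fun h => by
  have := hP.five_le ((hP.prime_dvd_dProd_iff Nat.prime_two).mp h)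
  norm_num at this

theorem not_three_dvd (hP : IsPrimeSet P) : ¬ (3 : ℤ) ∣ dProd P := fun h => by
  have := hP.five_le ((hP.prime_dvd_dProd_iff Nat.prime_three).mp h)
  norm_num at this

theorem odd_dProd (hP : IsPrimeSet P) : Odd (dProd P) :=
  Int.not_even_iff_odd.mp fun h => hP.not_two_dvd (even_iff_two_dvd.mp h)

theorem graphVertices_neg (hP : IsPrimeSet P) : graphVertices (-dProd P) = insert (-1) P := by
  have hpos := hP.dProd_pos subset_rfl
  ext v
  rw [mem_graphVertices_of_neg (by omega), Finset.mem_insert]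
  refine or_congr Iff.rfl ⟨?_, fun h => ?_⟩
  · rintro ⟨q, hq, hd, rfl⟩
    exact (hP.prime_dvd_dProd_iff hq).mp ((dvd_neg).mp hd)
  · obtain ⟨q, hq, -, rfl⟩ := hP v h
    exact ⟨q, hq, (dvd_neg).mpr ((hP.prime_dvd_dProd_iff hq).mpr h), rfl⟩

theorem graphVertices_neg_three (hP : IsPrimeSet P) :
    graphVertices (-3 * dProd P) = insert (-1) (insert 3 P) := by
  have hpos := hP.dProd_pos subset_rfl
  ext v
  rw [mem_graphVertices_of_neg (by omega), Finset.mem_insert, Finset.mem_insert]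
  refine or_congr Iff.rfl ⟨?_, fun h => ?_⟩
  · rintro ⟨q, hq, hd, rfl⟩
    rw [neg_mul, dvd_neg] at hd
    rcases (Nat.prime_iff_prime_int.mp hq).dvd_or_dvd hd with h | h
    · left
      have := (Nat.prime_dvd_prime_iff_eq hq Nat.prime_three).mp (by exact_mod_cast h)
      exact_mod_cast this
    · exact Or.inr ((hP.prime_dvd_dProd_iff hq).mp h)
  · rcases h with rfl | h
    · exact ⟨3, Nat.prime_three, ⟨-dProd P, by push_cast; ring⟩, rfl⟩
    · obtain ⟨q, hq, -, rfl⟩ := hP v h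
      exact ⟨q, hq, Dvd.dvd.mul_left ((hP.prime_dvd_dProd_iff hq).mpr h) _, rfl⟩

theorem notMem (hP : IsPrimeSet P) {v : ℤ} (hv : v < 5) : v ∉ P := fun h => by
  have := hP.five_le h; omega

theorem dProd_insert_neg_one (hP : IsPrimeSet P) : dProd (insert (-1) P) = -dProd P := by
  rw [dProd, Finset.prod_insert (hP.notMem (by norm_num))]
  simp [dProd]

theorem dProd_insert_neg_one_three (hP : IsPrimeSet P) :
    dProd (insert (-1) (insert 3 P)) = -3 * dProd P := by
  rw [dProd, Finset.prod_insert, Finset.prod_insert (hP.notMem (by norm_num))]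
  · simp only [dProd]; ring
  · rw [Finset.mem_insert, not_or]
    exact ⟨by norm_num, hP.notMem (by norm_num)⟩

theorem prime_dvd_disc_iff (hP : IsPrimeSet P) {q : ℕ} (hq : q.Prime) :
    (q : ℤ) ∣ disc (coeffA (dProd P)) (coeffB (dProd P)) ↔ q = 2 ∨ q = 3 ∨ (q : ℤ) ∈ P := by
  have hq' := Nat.prime_iff_prime_int.mp hq
  rw [disc_coeff, hq'.dvd_mul, hq'.dvd_pow_iff_dvd (by norm_num), hP.prime_dvd_dProd_iff hq,
    ← or_assoc]
  refine or_congr ?_ Iff.rfl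
  rw [show (144 : ℤ) = ((2 ^ 4 * 3 ^ 2 : ℕ) : ℤ) by norm_num, Int.natCast_dvd_natCast, hq.dvd_mul,
    hq.prime.dvd_pow_iff_dvd (by norm_num), hq.prime.dvd_pow_iff_dvd (by norm_num),
    Nat.prime_dvd_prime_iff_eq hq Nat.prime_two, Nat.prime_dvd_prime_iff_eq hq Nat.prime_three]

/-- The vertices of `G(-3n)` together with `2`: the generators of `D`. -/
theorem isVertexSet_insert (hP : IsPrimeSet P) :
    IsVertexSet (insert 2 (insert (-1) (insert 3 P))) := by
  intro v hv
  simp only [Finset.mem_insert] at hv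
  rcases hv with rfl | rfl | rfl | h
  · exact Or.inr ⟨2, Nat.prime_two, rfl⟩
  · exact Or.inl rfl
  · exact Or.inr ⟨3, Nat.prime_three, rfl⟩
  · exact hP.isVertexSet v h

theorem mem_classGroupD_iff (hP : IsPrimeSet P) (c : SqClass ℚ) :
    c ∈ classGroupD (coeffA (dProd P)) (coeffB (dProd P)) ↔
      ∃ W ⊆ insert 2 (insert (-1) (insert 3 P)), c = sqClass (dProd W : ℚ) := by
  rw [← mem_closure_iff_exists_dProd hP.isVertexSet_insert, classGroupD]
  have : ({sqClass (-1 : ℚ)} ∪ {c | ∃ p : ℕ, p.Prime ∧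
      (p : ℤ) ∣ disc (coeffA (dProd P)) (coeffB (dProd P)) ∧ c = sqClass (p : ℚ)}) =
      {c : SqClass ℚ | ∃ v ∈ insert 2 (insert (-1) (insert 3 P)), c = sqClass (v : ℚ)} := by
    ext c
    simp only [Set.mem_union, Set.mem_singleton_iff, Set.mem_ofPred_eq]
    constructor
    · rintro (rfl | ⟨q, hq, hd, rfl⟩)
      · exact ⟨-1, by simp, by simp⟩
      · refine ⟨q, ?_, by simp⟩
        rcases (hP.prime_dvd_disc_iff hq).mp hd with rfl | rfl | h
        · simp
        · simp
        · simp [h]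
    · rintro ⟨v, hv, rfl⟩
      by_cases h1 : v = -1
      · left; rw [h1]; simp
      · right
        obtain ⟨q, hq, rfl⟩ := (hP.isVertexSet_insert v hv).resolve_left h1
        refine ⟨q, hq, (hP.prime_dvd_disc_iff hq).mpr ?_, by simp⟩
        simp only [Finset.mem_insert] at hv
        rcases hv with h | h | h | h
        · exact Or.inl (by exact_mod_cast h)
        · exact absurd h h1
        · exact Or.inr (Or.inl (by exact_mod_cast h))
        · exact Or.inr (Or.inr h)
  rw [this]

theorem mem_localConditions_iff (hP : IsPrimeSet P) (a b : ℤ) (c : SqClass ℚ) :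
    c ∈ localConditions (coeffA (dProd P)) (coeffB (dProd P)) a b ↔
      ∃ W ⊆ insert 2 (insert (-1) (insert 3 P)), c = sqClass (dProd W : ℚ) ∧
        sqClass (dProd W : ℝ) ∈ Set.range (descentMap ℝ a b) ∧
        ∀ (q : ℕ) [Fact q.Prime], q = 2 ∨ q = 3 ∨ (q : ℤ) ∈ P →
          sqClass (dProd W : ℚ_[q]) ∈ Set.range (descentMap ℚ_[q] a b) := by
  have hloc : ∀ W ⊆ insert 2 (insert (-1) (insert 3 P)), ∀ (K : Type) [Field K] [CharZero K],
      localize K (sqClass (dProd W : ℚ)) = sqClass (dProd W : K) := by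
    intro W hW K _ _
    have : (dProd W : ℚ) ≠ 0 := by
      exact_mod_cast (hP.isVertexSet_insert.mono hW).dProd_ne_zero
    rw [localize_sqClass K this, Rat.cast_intCast]
  constructor
  · rintro ⟨hD, hR, hp⟩
    obtain ⟨W, hW, rfl⟩ := (hP.mem_classGroupD_iff c).mp hD
    refine ⟨W, hW, rfl, by rwa [hloc W hW] at hR, fun q hq h => ?_⟩
    have := hp q ((hP.prime_dvd_disc_iff hq.out).mpr h)
    rwa [hloc W hW] at this
  · rintro ⟨W, hW, rfl, hR, hp⟩
    refine ⟨(hP.mem_classGroupD_iff _).mpr ⟨W, hW, rfl⟩, by rwa [hloc W hW], fun q hq h => ?_⟩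
    rw [hloc W hW]
    exact hp q ((hP.prime_dvd_disc_iff hq.out).mp h)

theorem norm_dProd (hP : IsPrimeSet P) {q : ℕ} [hq : Fact q.Prime] (h : (q : ℤ) ∈ P) :
    ‖(dProd P : ℚ_[q])‖ = (q : ℝ)⁻¹ :=
  norm_intCast_of_dvd ((hP.prime_dvd_dProd_iff hq.out).mpr h) (hP.isVertexSet.sq_not_dvd hq.out)

theorem odd_dProd_iff (hP : IsPrimeSet P) {W : Finset ℤ}
    (hW : W ⊆ insert 2 (insert (-1) (insert 3 P))) : Odd (dProd W) ↔ (2 : ℤ) ∉ W := by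
  rw [← Int.not_even_iff_odd, even_iff_two_dvd]
  exact not_congr ((hP.isVertexSet_insert.mono hW).dvd_dProd_iff Nat.prime_two)

/-- Only `2` and the primes `q ≡ 1 (mod 3)` impose conditions. At such `q` the image `{1, -3n}` is
`{1, d(V)}` for the vertex set `V` of `G(-3n)`. -/
theorem mem_selmer'_iff (hP : IsPrimeSet P) (c : SqClass ℚ) :
    c ∈ selmer' (coeffA (dProd P)) (coeffB (dProd P)) ↔
      ∃ W ⊆ graphVertices (-3 * dProd P), c = sqClass (dProd W : ℚ) ∧
        (dProd P ≡ 5 [ZMOD 8] → dProd W ≡ 1 [ZMOD 4]) ∧ ¬ OddIn (-3 * dProd P) W := by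
  have hn0 : dProd P ≠ 0 := hP.isVertexSet.dProd_ne_zero
  have hVS := hP.isVertexSet_insert
  have hmneg : -3 * dProd P < 0 := by have := hP.dProd_pos subset_rfl; omega
  have hV := isVertexSet_graphVertices_of_neg hmneg
  have h2V : (2 : ℤ) ∉ graphVertices (-3 * dProd P) := by
    rw [hP.graphVertices_neg_three]
    simp [hP.notMem (show (2 : ℤ) < 5 by norm_num)]
  rw [selmer', hP.mem_localConditions_iff]
  refine exists_congr fun W => ?_
  constructor
  · rintro ⟨hW, rfl, -, hp⟩
    have hd0 := (hVS.mono hW).dProd_ne_zero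
    have h2 := hp 2 (Or.inl rfl)
    rw [mem_range_curve_iff hn0 (by exact_mod_cast hd0),
      fromCurve_two_iff hP.odd_dProd (hVS.mono hW).squarefree_dProd, hP.odd_dProd_iff hW] at h2
    have hW' : W ⊆ graphVertices (-3 * dProd P) := by
      rw [hP.graphVertices_neg_three]
      exact (Finset.subset_insert_iff_of_notMem h2.1).mp hW
    refine ⟨hW', rfl, h2.2, ?_⟩
    rw [not_oddIn_iff hV h2V hW']
    intro q hq hqV h1
    rw [hP.graphVertices_neg_three, hP.dProd_insert_neg_one_three]
    have hqP : (q : ℤ) ∈ P := by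
      rw [hP.graphVertices_neg_three] at hqV
      simp only [Finset.mem_insert] at hqV
      rcases hqV with h | h | h
      · omega
      · have : q = 3 := by exact_mod_cast h
        subst this
        exact absurd h1 (by decide)
      · exact h
    have h5 : 5 ≤ q := by exact_mod_cast hP.five_le hqP
    have := hp q (Or.inr (Or.inr hqP))
    rw [mem_range_curve_iff hn0 (by exact_mod_cast hd0), fromCurve_iff_of_isSquare_neg_three h5
      (hP.norm_dProd hqP) ((isSquare_neg_three_iff h5).mpr h1)] at this
    push_cast
    exact this
  · rintro ⟨hW, rfl, h4, hodd⟩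
    rw [not_oddIn_iff hV h2V hW, hP.graphVertices_neg_three, hP.dProd_insert_neg_one_three] at hodd
    have h2W : (2 : ℤ) ∉ W := fun h => h2V (hW h)
    rw [hP.graphVertices_neg_three] at hW
    have hWU := hW.trans (Finset.subset_insert 2 _)
    have hd0 := (hVS.mono hWU).dProd_ne_zero
    refine ⟨hWU, rfl, ?_, fun q hq hqd => ?_⟩
    · rw [mem_range_curve_iff hn0 (by exact_mod_cast hd0)]
      exact fromCurve_real
    · rw [mem_range_curve_iff hn0 (by exact_mod_cast hd0)]
      rcases hqd with rfl | rfl | hqP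
      · rw [fromCurve_two_iff hP.odd_dProd (hVS.mono hWU).squarefree_dProd, hP.odd_dProd_iff hWU]
        exact ⟨h2W, h4⟩
      · exact fromCurve_three hP.not_three_dvd (by exact_mod_cast hd0)
      · have h5 : 5 ≤ q := by exact_mod_cast hP.five_le hqP
        by_cases h1 : q ≡ 1 [MOD 3]
        · rw [fromCurve_iff_of_isSquare_neg_three h5 (hP.norm_dProd hqP)
            ((isSquare_neg_three_iff h5).mpr h1)]
          have := hodd q (by simp [hqP]) h1
          push_cast at this
          exact this
        · exact fromCurve_of_not_isSquare_neg_three h5 (hP.norm_dProd hqP)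
            (fun h => h1 ((isSquare_neg_three_iff h5).mp h)) (by exact_mod_cast hd0)

/-- The places `2`, `∞` and `3` remove the generators `2`, `-1` and `3`, leaving subsets of `P`. At
`q ≡ 1 (mod 3)` the image `{1, -n}` is `{1, d(V)}` for the vertex set `V` of `G(-n)`. -/
theorem mem_selmer_iff (hP : IsPrimeSet P) (c : SqClass ℚ) :
    c ∈ selmer (coeffA (dProd P)) (coeffB (dProd P)) ↔
      ∃ W ⊆ P, c = sqClass (dProd W : ℚ) ∧ dProd W ≡ 1 [ZMOD 3] ∧
        (¬ dProd P ≡ 5 [ZMOD 8] → dProd W ≡ 1 [ZMOD 4]) ∧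
        (∀ (q : ℕ) [Fact q.Prime], (q : ℤ) ∈ P → ¬ q ≡ 1 [MOD 3] →
          IsSquare (dProd W : ℚ_[q])) ∧ ¬ OddIn (-dProd P) W := by
  have hn0 : dProd P ≠ 0 := hP.isVertexSet.dProd_ne_zero
  have hVS := hP.isVertexSet_insert
  have hmneg : -dProd P < 0 := by have := hP.dProd_pos subset_rfl; omega
  have hV := isVertexSet_graphVertices_of_neg hmneg
  have h2V : (2 : ℤ) ∉ graphVertices (-dProd P) := by
    rw [hP.graphVertices_neg]
    simp [hP.notMem (show (2 : ℤ) < 5 by norm_num)]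
  rw [selmer, hP.mem_localConditions_iff]
  refine exists_congr fun W => ?_
  constructor
  · rintro ⟨hW, rfl, hR, hp⟩
    have hdV := hVS.mono hW
    have hd0 := hdV.dProd_ne_zero
    have h2 := hp 2 (Or.inl rfl)
    rw [mem_range_isogenous_iff hn0 (by exact_mod_cast hd0),
      fromIsogenous_two_iff hP.odd_dProd hdV.squarefree_dProd, hP.odd_dProd_iff hW] at h2
    have h3 := hp 3 (Or.inr (Or.inl rfl))
    rw [mem_range_isogenous_iff hn0 (by exact_mod_cast hd0),
      fromIsogenous_three_iff hP.not_three_dvd] at h3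
    rw [mem_range_isogenous_iff hn0 (by exact_mod_cast hd0),
      fromIsogenous_real_iff hn0 (by exact_mod_cast hd0)] at hR
    have hdpos : 0 < dProd W := by exact_mod_cast hR
    have h3W : (3 : ℤ) ∉ W := fun h => not_isSquare_of_norm_eq_inv
      (norm_intCast_of_dvd ((hdV.dvd_dProd_iff Nat.prime_three).mpr h)
        (hdV.sq_not_dvd Nat.prime_three)) h3
    have hnegW : (-1 : ℤ) ∉ W := fun h => by
      have e : dProd W = -1 * dProd (W.erase (-1)) :=
        (Finset.mul_prod_erase W (fun v => v) h).symm
      have : 0 < dProd (W.erase (-1)) := by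
        refine Finset.prod_pos fun v hv => ?_
        rw [Finset.mem_erase] at hv
        rcases hdV v hv.2 with h | ⟨r, hr, rfl⟩
        · exact absurd h hv.1
        · exact_mod_cast hr.pos
      omega
    have hWP : W ⊆ P := by
      have h1 := (Finset.subset_insert_iff_of_notMem h2.1).mp hW
      have h1 := (Finset.subset_insert_iff_of_notMem hnegW).mp h1
      exact (Finset.subset_insert_iff_of_notMem h3W).mp h1
    have hW' : W ⊆ graphVertices (-dProd P) := by
      rw [hP.graphVertices_neg]
      exact hWP.trans (Finset.subset_insert _ _)
    have hloc : ∀ (q : ℕ) [Fact q.Prime], (q : ℤ) ∈ P →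
        FromIsogenous ℚ_[q] (dProd P) (dProd W : ℚ_[q]) := fun q hq hqP => by
      have := hp q (Or.inr (Or.inr hqP))
      rwa [mem_range_isogenous_iff hn0 (by exact_mod_cast hd0)] at this
    refine ⟨hWP, rfl, ?_, h2.2, fun q hq hqP h1 => ?_, ?_⟩
    · have h3d : ¬ (3 : ℤ) ∣ dProd W := fun h =>
        h3W ((hdV.dvd_dProd_iff Nat.prime_three).mp h)
      by_contra h
      refine not_isSquare_three_of_modEq ?_ h3
      unfold Int.ModEq at h ⊢; omega
    · have h5 : 5 ≤ q := by exact_mod_cast hP.five_le hqP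
      exact (fromIsogenous_iff_of_not_isSquare_neg_three h5 (hP.norm_dProd hqP)
        (fun h => h1 ((isSquare_neg_three_iff h5).mp h))).mp (hloc q hqP)
    · rw [not_oddIn_iff hV h2V hW']
      intro q hq hqV h1
      rw [hP.graphVertices_neg, hP.dProd_insert_neg_one]
      have hqP : (q : ℤ) ∈ P := by
        rw [hP.graphVertices_neg, Finset.mem_insert] at hqV
        exact hqV.resolve_left (by omega)
      have h5 : 5 ≤ q := by exact_mod_cast hP.five_le hqP
      push_cast
      exact (fromIsogenous_iff_of_isSquare_neg_three h5 (hP.norm_dProd hqP)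
        ((isSquare_neg_three_iff h5).mpr h1)).mp (hloc q hqP)
  · rintro ⟨hW, rfl, h3, h4, hbad, hodd⟩
    have hW' : W ⊆ graphVertices (-dProd P) := by
      rw [hP.graphVertices_neg]
      exact hW.trans (Finset.subset_insert _ _)
    rw [not_oddIn_iff hV h2V hW', hP.graphVertices_neg, hP.dProd_insert_neg_one] at hodd
    have h2W : (2 : ℤ) ∉ W := fun h => h2V (hW' h)
    have hWU : W ⊆ insert 2 (insert (-1) (insert 3 P)) := hW.trans (by
      intro v hv; simp [hv])
    have hd0 := (hVS.mono hWU).dProd_ne_zero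
    refine ⟨hWU, rfl, ?_, fun q hq hqd => ?_⟩
    · rw [mem_range_isogenous_iff hn0 (by exact_mod_cast hd0),
        fromIsogenous_real_iff hn0 (by exact_mod_cast hd0)]
      exact_mod_cast hP.dProd_pos hW
    · rw [mem_range_isogenous_iff hn0 (by exact_mod_cast hd0)]
      rcases hqd with rfl | rfl | hqP
      · rw [fromIsogenous_two_iff hP.odd_dProd (hVS.mono hWU).squarefree_dProd,
          hP.odd_dProd_iff hWU]
        exact ⟨h2W, h4⟩
      · exact Or.inl (isSquare_three_of_modEq h3)
      · by_cases h1 : q ≡ 1 [MOD 3]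
        · have h5 : 5 ≤ q := by exact_mod_cast hP.five_le hqP
          rw [fromIsogenous_iff_of_isSquare_neg_three h5 (hP.norm_dProd hqP)
            ((isSquare_neg_three_iff h5).mpr h1)]
          have := hodd q (by simp [hqP]) h1
          push_cast at this
          exact this
        · exact Or.inl (hbad q hqP h1)

end IsPrimeSet

/-! ### Criteria for minimal Selmer sets -/

namespace IsPrimeSet

variable {P : Finset ℤ}

theorem five_le_of_mem_graphVertices (hP : IsPrimeSet P) {q : ℕ}
    (hq : (q : ℤ) ∈ graphVertices (-3 * dProd P)) (h1 : q ≡ 1 [MOD 3]) : 5 ≤ q := by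
  rw [hP.graphVertices_neg_three] at hq
  simp only [Finset.mem_insert] at hq
  rcases hq with h | h | h
  · omega
  · have : q = 3 := by exact_mod_cast h
    subst this
    exact absurd h1 (by decide)
  · exact_mod_cast hP.five_le h

theorem two_notMem_graphVertices (hP : IsPrimeSet P) :
    (2 : ℤ) ∉ graphVertices (-3 * dProd P) := by
  rw [hP.graphVertices_neg_three]
  simp [hP.notMem (show (2 : ℤ) < 5 by norm_num)]

theorem isVertexSet_graphVertices (hP : IsPrimeSet P) :
    IsVertexSet (graphVertices (-3 * dProd P)) :=
  isVertexSet_graphVertices_of_neg (by have := hP.dProd_pos subset_rfl; omega)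

/-- The partitions coming from the rational 2-torsion points are not odd. -/
theorem not_oddIn_of_torsion (hP : IsPrimeSet P) {W : Finset ℤ}
    (hW : W = ∅ ∨ W = graphVertices (-3 * dProd P) ∨ W = {-1, 3} ∨ W = P) :
    W ⊆ graphVertices (-3 * dProd P) ∧ ¬ OddIn (-3 * dProd P) W := by
  have hsub : W ⊆ graphVertices (-3 * dProd P) := by
    rw [hP.graphVertices_neg_three]
    rcases hW with rfl | rfl | rfl | rfl
    · exact Finset.empty_subset _
    · rw [hP.graphVertices_neg_three]
    · intro v hv
      simp only [Finset.mem_insert, Finset.mem_singleton] at hv ⊢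
      tauto
    · intro v hv
      simp [hv]
  refine ⟨hsub, ?_⟩
  rw [not_oddIn_iff hP.isVertexSet_graphVertices hP.two_notMem_graphVertices hsub]
  intro q hq hqV h1
  have h3 : IsSquare (-3 : ℚ_[q]) :=
    (isSquare_neg_three_iff (hP.five_le_of_mem_graphVertices hqV h1)).mpr h1
  rcases hW with rfl | rfl | rfl | rfl
  · left; simp [dProd]
  · right; exact ⟨_, rfl⟩
  · left; simpa [dProd] using h3
  · right
    rw [hP.graphVertices_neg_three, hP.dProd_insert_neg_one_three]
    push_cast
    rw [mul_left_comm]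
    exact h3.mul ⟨_, rfl⟩

/-- The four listed classes are `d(W)` for `W = ∅`, `P`, `V`, `{-1, 3}`. They always lie in `S'(E)`,
so by injectivity of `W ↦ d(W)` equality means that no further `W` is even. -/
theorem selmer'_eq_iff (hP : IsPrimeSet P) :
    selmer' (coeffA (dProd P)) (coeffB (dProd P)) =
        {sqClass (1 : ℚ), sqClass (dProd P : ℚ), sqClass (-3 * dProd P : ℚ), sqClass (-3 : ℚ)} ↔
      ∀ W ⊆ graphVertices (-3 * dProd P), (dProd P ≡ 5 [ZMOD 8] → dProd W ≡ 1 [ZMOD 4]) →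
        W ≠ ∅ → W ≠ graphVertices (-3 * dProd P) → W ≠ {-1, 3} → W ≠ P →
        OddIn (-3 * dProd P) W := by
  have e1 : sqClass (1 : ℚ) = sqClass (dProd ∅ : ℚ) := by simp [dProd]
  have e2 : sqClass (-3 * dProd P : ℚ) =
      sqClass (dProd (graphVertices (-3 * dProd P)) : ℚ) := by
    rw [hP.graphVertices_neg_three, hP.dProd_insert_neg_one_three]
    push_cast
    rfl
  have e3 : sqClass (-3 : ℚ) = sqClass (dProd {-1, 3} : ℚ) := by simp [dProd]
  rw [e1, e2, e3]
  have hinj : ∀ W₁ ⊆ graphVertices (-3 * dProd P), ∀ W₂ ⊆ graphVertices (-3 * dProd P),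
      sqClass (dProd W₁ : ℚ) = sqClass (dProd W₂ : ℚ) → W₁ = W₂ := fun W₁ h₁ W₂ h₂ h =>
    sqClass_dProd_injOn hP.isVertexSet_graphVertices h₁ h₂ h
  constructor
  · intro h W hW h4 n1 n2 n3 n4
    by_contra hodd
    have hmem := (hP.mem_selmer'_iff (sqClass (dProd W : ℚ))).mpr ⟨W, hW, rfl, h4, hodd⟩
    rw [h] at hmem
    rcases hmem with h | h | h | h
    · exact n1 (hinj W hW _ (hP.not_oddIn_of_torsion (by tauto)).1 h)
    · exact n4 (hinj W hW _ (hP.not_oddIn_of_torsion (by tauto)).1 h)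
    · exact n2 (hinj W hW _ subset_rfl h)
    · exact n3 (hinj W hW _ (hP.not_oddIn_of_torsion (by tauto)).1 h)
  · intro h
    have hmem : ∀ W, (W = ∅ ∨ W = graphVertices (-3 * dProd P) ∨ W = {-1, 3} ∨ W = P) →
        sqClass (dProd W : ℚ) ∈ selmer' (coeffA (dProd P)) (coeffB (dProd P)) := by
      intro W hW
      have hW' := hP.not_oddIn_of_torsion hW
      refine (hP.mem_selmer'_iff _).mpr ⟨W, hW'.1, rfl, fun h5 => ?_, hW'.2⟩
      rcases hW with rfl | rfl | rfl | rfl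
      · rfl
      · rw [hP.graphVertices_neg_three, hP.dProd_insert_neg_one_three]
        unfold Int.ModEq at h5 ⊢; omega
      · decide
      · unfold Int.ModEq at h5 ⊢; omega
    ext c
    constructor
    · intro hc
      obtain ⟨W, hW, rfl, h4, hodd⟩ := (hP.mem_selmer'_iff c).mp hc
      by_contra hne
      simp only [Set.mem_insert_iff, Set.mem_singleton_iff, not_or] at hne
      refine hodd (h W hW h4 ?_ ?_ ?_ ?_) <;> rintro rfl
      · exact hne.1 rfl
      · exact hne.2.2.1 rfl
      · exact hne.2.2.2 rfl
      · exact hne.2.1 rfl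
    · rintro (rfl | rfl | rfl | rfl)
      · exact hmem _ (by tauto)
      · exact hmem _ (by tauto)
      · exact hmem _ (by tauto)
      · exact hmem _ (by tauto)

theorem selmer_eq_iff (hP : IsPrimeSet P) :
    selmer (coeffA (dProd P)) (coeffB (dProd P)) = {sqClass (1 : ℚ)} ↔
      ∀ W ⊆ P, W ≠ ∅ → dProd W ≡ 1 [ZMOD 3] →
        (¬ dProd P ≡ 5 [ZMOD 8] → dProd W ≡ 1 [ZMOD 4]) →
        (∀ (q : ℕ) [Fact q.Prime], (q : ℤ) ∈ P → ¬ q ≡ 1 [MOD 3] →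
          IsSquare (dProd W : ℚ_[q])) → OddIn (-dProd P) W := by
  have e1 : sqClass (1 : ℚ) = sqClass (dProd ∅ : ℚ) := by simp [dProd]
  rw [e1]
  constructor
  · intro h W hW hne h3 h4 hbad
    by_contra hodd
    have hmem := (hP.mem_selmer_iff (sqClass (dProd W : ℚ))).mpr ⟨W, hW, rfl, h3, h4, hbad, hodd⟩
    rw [h] at hmem
    exact hne (sqClass_dProd_injOn hP.isVertexSet hW (Finset.empty_subset _) hmem)
  · intro h
    ext c
    rw [hP.mem_selmer_iff, Set.mem_singleton_iff]
    constructor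
    · rintro ⟨W, hW, rfl, h3, h4, hbad, hodd⟩
      by_contra hne
      exact hodd (h W hW (by rintro rfl; exact hne rfl) h3 h4 hbad)
    · rintro rfl
      have h2 : (2 : ℤ) ∉ graphVertices (-dProd P) := by
        rw [hP.graphVertices_neg]
        simp [hP.notMem (show (2 : ℤ) < 5 by norm_num)]
      refine ⟨∅, Finset.empty_subset _, rfl, rfl, fun _ => rfl, fun q hq _ _ => ?_, ?_⟩
      · simp [dProd]
      · rw [not_oddIn_iff (isVertexSet_graphVertices_of_neg
          (by have := hP.dProd_pos subset_rfl; omega)) h2 (Finset.empty_subset _)]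
        intro q hq _ _
        left; simp [dProd]

end IsPrimeSet

/-! ### Counting primes that are not `1 mod 3` -/

section Family

variable {t : ℕ} {p : Fin t → ℕ} [hp : ∀ i, Fact (p i).Prime]

theorem isPrimeSet_image (hp5 : ∀ i, 5 ≤ p i) :
    IsPrimeSet (Finset.univ.image fun i => (p i : ℤ)) := by
  intro v hv
  obtain ⟨i, -, rfl⟩ := Finset.mem_image.mp hv
  exact ⟨p i, (hp i).out, hp5 i, rfl⟩

/-- If `S'(E)` is as small as possible, then at most one `p i` is not `1` modulo `3`. -/
theorem eq_of_not_modEq (hp5 : ∀ i, 5 ≤ p i) (hinj : Function.Injective p) {P : Finset ℤ}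
    (hPdef : P = Finset.univ.image fun i => (p i : ℤ))
    (h : ∀ W ⊆ graphVertices (-3 * dProd P), (dProd P ≡ 5 [ZMOD 8] → dProd W ≡ 1 [ZMOD 4]) →
        W ≠ ∅ → W ≠ graphVertices (-3 * dProd P) → W ≠ {-1, 3} → W ≠ P →
        OddIn (-3 * dProd P) W) {i j : Fin t} (hi : ¬ p i ≡ 1 [MOD 3])
    (hj : ¬ p j ≡ 1 [MOD 3]) : i = j := by
  classical
  have hP : IsPrimeSet P := hPdef ▸ isPrimeSet_image hp5
  set V := graphVertices (-3 * dProd P) with hVdef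
  have hV : IsVertexSet V := hP.isVertexSet_graphVertices
  have h2V : (2 : ℤ) ∉ V := hP.two_notMem_graphVertices
  have hVcard : V.card = t + 2 := by
    rw [hVdef, hP.graphVertices_neg_three, Finset.card_insert_of_notMem,
      Finset.card_insert_of_notMem (hP.notMem (by norm_num)), hPdef, Finset.card_image_of_injective,
      Finset.card_univ, Fintype.card_fin]
    · exact Nat.cast_injective.comp hinj
    · rw [Finset.mem_insert, not_or]
      exact ⟨by norm_num, hP.notMem (by norm_num)⟩
  -- The extra character `χ₄` forces `d(W) ≡ 1 (mod 4)`, so one count serves every residue of `n`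
  -- mod 8.
  let a : Option {i : Fin t // p i ≡ 1 [MOD 3]} → ℤ → ℤ
    | none, v => ZMod.χ₄ v
    | some i, v => vertexChar V (p i) v
  have hoddV : ∀ v ∈ V, v % 2 = 1 := by
    intro v hv
    have : ¬ ((2 : ℕ) : ℤ) ∣ v := fun h => by
      rw [(hV.dvd_iff Nat.prime_two hv).mp h] at hv
      exact h2V hv
    omega
  have ha : ∀ o, ∀ v ∈ V, a o v = 1 ∨ a o v = -1 := by
    rintro (_ | k) v hv
    · have h1 := hoddV v hv
      have h2 : v % 4 = 1 ∨ v % 4 = 3 := by omega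
      rcases h2 with h2 | h2
      · exact Or.inl (ZMod.χ₄_int_one_mod_four h2)
      · exact Or.inr (ZMod.χ₄_int_three_mod_four h2)
    · exact hV.vertexChar_eq hv
  have hcount := two_pow_card_le_card_ker V a ha
  have hker : (V.powerset.filter fun W => ∀ o, ∏ v ∈ W, a o v = 1).card ≤ 4 := by
    refine (Finset.card_le_card (t := {∅, V, {-1, 3}, P}) ?_).trans Finset.card_le_four
    intro W hW
    rw [Finset.mem_filter, Finset.mem_powerset] at hW
    by_contra hne
    simp only [Finset.mem_insert, Finset.mem_singleton, not_or] at hne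
    have h4 : dProd W ≡ 1 [ZMOD 4] := by
      have h1 : ZMod.χ₄ (dProd W : ZMod 4) = 1 := by
        rw [dProd, Int.cast_prod, map_prod]
        exact hW.2 none
      have h2 : dProd W % 2 = 1 := by
        have : ¬ ((2 : ℕ) : ℤ) ∣ dProd W := fun h =>
          h2V (hW.1 (((hV.mono hW.1).dvd_dProd_iff Nat.prime_two).mp h))
        omega
      rw [ZMod.χ₄_int_eq_if_mod_four, if_neg (by omega)] at h1
      split_ifs at h1 with h5
      exact h5
    have hodd := h W hW.1 (fun _ => h4) hne.1 hne.2.1 hne.2.2.1 hne.2.2.2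
    obtain ⟨q, hq, hqV, h1, hm⟩ := (oddIn_iff hV hW.1).mp hodd
    have h5 := hP.five_le_of_mem_graphVertices hqV h1
    have hqP : (q : ℤ) ∈ P := by
      rw [hP.graphVertices_neg_three] at hqV
      simp only [Finset.mem_insert] at hqV
      rcases hqV with h | h | h
      · omega
      · omega
      · exact h
    rw [hPdef] at hqP
    obtain ⟨k, -, hk⟩ := Finset.mem_image.mp hqP
    obtain rfl : p k = q := by exact_mod_cast hk
    have h2 := hW.2 (some ⟨k, h1⟩)
    have h3 : ∏ v ∈ W, vertexChar V (p k) v = 1 := h2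
    rw [hm] at h3
    norm_num at h3
  by_contra hij
  have hcard : Fintype.card {i : Fin t // p i ≡ 1 [MOD 3]} + 2 ≤ t := by
    have h1 := Fintype.card_subtype_compl (fun i : Fin t => p i ≡ 1 [MOD 3])
    have h2 := Fintype.card_subtype_le (fun i : Fin t => p i ≡ 1 [MOD 3])
    have h3 : 1 < Fintype.card {i : Fin t // ¬ p i ≡ 1 [MOD 3]} :=
      Fintype.one_lt_card_iff.mpr ⟨⟨i, hi⟩, ⟨j, hj⟩, fun h => hij (congrArg Subtype.val h)⟩
    rw [Fintype.card_fin] at h1 h2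
    omega
  rw [hVcard, Fintype.card_option] at hcount
  -- At most four subsets survive `r + 1` conditions, so `t + 2 ≤ r + 3`. This contradicts `r + 2 ≤
  -- t`.
  have h1 : 2 ^ (t + 2) ≤ 2 ^ (Fintype.card {i : Fin t // p i ≡ 1 [MOD 3]} + 3) := by
    calc 2 ^ (t + 2) ≤ 4 * 2 ^ (Fintype.card {i : Fin t // p i ≡ 1 [MOD 3]} + 1) :=
          hcount.trans (Nat.mul_le_mul_right _ hker)
      _ = _ := by ring
  have := (Nat.pow_le_pow_iff_right (by norm_num : 1 < 2)).mp h1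
  omega

theorem dProd_modEq_one_of_forall {W : Finset ℤ} (h : ∀ v ∈ W, v ≡ 1 [ZMOD 3]) :
    dProd W ≡ 1 [ZMOD 3] :=
  Finset.prod_induction _ (fun x => x ≡ 1 [ZMOD 3]) (fun _ _ hx hy => hx.mul hy) rfl h

end Family

end SelmerTwo

/-! ### Assembly by residues of `n` mod 8 and mod 3 -/

theorem theorem4p1 (t : ℕ) (ht : 1 ≤ t) (p : Fin t → ℕ) [hp : ∀ i, Fact (p i).Prime]
    (hp5 : ∀ i, 5 ≤ p i) (hinj : Function.Injective p)
    (n : ℤ) (hn : n = ∏ i, (p i : ℤ)) (P : Finset ℤ)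
    (hP : P = Finset.univ.image (fun i => (p i : ℤ))) :
    -- (I)
    ((n ≡ 1 [ZMOD 24] ∨ n ≡ 7 [ZMOD 24] ∨ n ≡ 19 [ZMOD 24]) →
      -- (I.1)
      (SelmerTwo.selmer' (SelmerTwo.coeffA n) (SelmerTwo.coeffB n) =
          {SelmerTwo.sqClass (1 : ℚ), SelmerTwo.sqClass (n : ℚ),
            SelmerTwo.sqClass (-3 * n : ℚ), SelmerTwo.sqClass (-3 : ℚ)} ↔
        (∀ i, p i ≡ 1 [MOD 3]) ∧
        ∀ V₁ ⊆ SelmerTwo.graphVertices (-3 * n),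
          V₁ ≠ ∅ → V₁ ≠ SelmerTwo.graphVertices (-3 * n) → V₁ ≠ {-1, 3} → V₁ ≠ P →
          SelmerTwo.OddIn (-3 * n) V₁) ∧
      -- (I.2)
      ((∀ i, p i ≡ 1 [MOD 3]) →
        (SelmerTwo.selmer (SelmerTwo.coeffA n) (SelmerTwo.coeffB n) =
            {SelmerTwo.sqClass (1 : ℚ)} ↔
          ∀ V₁ ⊆ P, 1 < SelmerTwo.dProd V₁ → SelmerTwo.dProd V₁ ≡ 1 [ZMOD 4] →
            SelmerTwo.OddIn (-n) V₁))) ∧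
    -- (II)
    (n ≡ 5 [ZMOD 24] →
      -- (II.1)
      (SelmerTwo.selmer' (SelmerTwo.coeffA n) (SelmerTwo.coeffB n) =
          {SelmerTwo.sqClass (1 : ℚ), SelmerTwo.sqClass (n : ℚ),
            SelmerTwo.sqClass (-3 * n : ℚ), SelmerTwo.sqClass (-3 : ℚ)} ↔
        (∃ j, p j ≡ 2 [MOD 3] ∧ ∀ i, i ≠ j → p i ≡ 1 [MOD 3]) ∧
        ∀ V₁ ⊆ SelmerTwo.graphVertices (-3 * n),
          SelmerTwo.dProd V₁ ≡ 1 [ZMOD 4] →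
          V₁ ≠ ∅ → V₁ ≠ SelmerTwo.graphVertices (-3 * n) → V₁ ≠ {-1, 3} → V₁ ≠ P →
          SelmerTwo.OddIn (-3 * n) V₁) ∧
      -- (II.2)
      (∀ j, p j ≡ 2 [MOD 3] → (∀ i, i ≠ j → p i ≡ 1 [MOD 3]) →
        (SelmerTwo.selmer (SelmerTwo.coeffA n) (SelmerTwo.coeffB n) =
            {SelmerTwo.sqClass (1 : ℚ)} ↔
          ∀ V₁ ⊆ P.erase (p j : ℤ), V₁ ≠ ∅ → legendreSym (p j) (SelmerTwo.dProd V₁) = 1 →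
            SelmerTwo.OddIn (-n) V₁))) := by
  have hPS : SelmerTwo.IsPrimeSet P := hP ▸ SelmerTwo.isPrimeSet_image hp5
  have hcast : Function.Injective fun i => (p i : ℤ) := Nat.cast_injective.comp hinj
  obtain rfl : n = SelmerTwo.dProd P := by
    rw [hn, hP, SelmerTwo.dProd, Finset.prod_image fun a _ b _ hab => hcast hab]
  have hmem : ∀ i, (p i : ℤ) ∈ P := fun i => hP ▸ Finset.mem_image_of_mem _ (Finset.mem_univ i)
  have hmem' : ∀ v ∈ P, ∃ i, v = p i := fun v hv => by
    rw [hP] at hv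
    obtain ⟨i, -, h⟩ := Finset.mem_image.mp hv
    exact ⟨i, h.symm⟩
  have hmod : ∀ i, p i ≡ 1 [MOD 3] ∨ p i ≡ 2 [MOD 3] := fun i => by
    have : ¬ 3 ∣ p i := fun h => by
      have := (Nat.prime_dvd_prime_iff_eq Nat.prime_three (hp i).out).mp h
      have := hp5 i
      omega
    unfold Nat.ModEq; omega
  have hgood : ∀ i, p i ≡ 1 [MOD 3] → (p i : ℤ) ≡ 1 [ZMOD 3] := fun i h => by
    exact_mod_cast (Int.natCast_modEq_iff (a := p i) (b := 1)).mpr h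
  have hbad : ∀ j, p j ≡ 2 [MOD 3] → (∀ i, i ≠ j → p i ≡ 1 [MOD 3]) →
      SelmerTwo.dProd P ≡ 2 [ZMOD 3] := fun j hj hi => by
    have e : SelmerTwo.dProd P = p j * SelmerTwo.dProd (P.erase (p j)) :=
      (Finset.mul_prod_erase P (fun v => v) (hmem j)).symm
    rw [e]
    have h1 : SelmerTwo.dProd (P.erase (p j)) ≡ 1 [ZMOD 3] := by
      refine SelmerTwo.dProd_modEq_one_of_forall fun v hv => ?_
      rw [Finset.mem_erase] at hv
      obtain ⟨i, rfl⟩ := hmem' v hv.2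
      exact hgood i (hi i fun h => hv.1 (by rw [h]))
    have h2 : (p j : ℤ) ≡ 2 [ZMOD 3] := by
      exact_mod_cast (Int.natCast_modEq_iff (a := p j) (b := 2)).mpr hj
    simpa using h2.mul h1
  refine ⟨fun hn24 => ⟨?_, fun hall => ?_⟩, fun hn24 => ⟨?_, fun j hj hi => ?_⟩⟩
  · have hn5 : ¬ SelmerTwo.dProd P ≡ 5 [ZMOD 8] := by unfold Int.ModEq at *; omega
    rw [hPS.selmer'_eq_iff]
    constructor
    · intro h
      refine ⟨fun j => ?_, fun W hW => h W hW fun h5 => absurd h5 hn5⟩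
      by_contra hj
      have hi : ∀ i, i ≠ j → p i ≡ 1 [MOD 3] := fun i hij => by
        by_contra hi
        exact hij (SelmerTwo.eq_of_not_modEq hp5 hinj hP h hi hj)
      -- A single prime `≡ 2 (mod 3)` would make `n ≡ 2 (mod 3)`, whereas `1`, `7` and `19` are all
      -- `1 mod 3`.
      have := hbad j ((hmod j).resolve_left hj) hi
      unfold Int.ModEq at *; omega
    · rintro ⟨-, h⟩ W hW -
      exact h W hW
  · have hn5 : ¬ SelmerTwo.dProd P ≡ 5 [ZMOD 8] := by unfold Int.ModEq at *; omega
    rw [hPS.selmer_eq_iff]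
    have hallP : ∀ v ∈ P, v ≡ 1 [ZMOD 3] := fun v hv => by
      obtain ⟨i, rfl⟩ := hmem' v hv
      exact hgood i (hall i)
    constructor
    · intro h W hW h1 h4
      refine h W hW (by rintro rfl; simp [SelmerTwo.dProd] at h1)
        (SelmerTwo.dProd_modEq_one_of_forall fun v hv => hallP v (hW hv)) (fun _ => h4) ?_
      intro q hq hqP hne
      obtain ⟨i, hi⟩ := hmem' _ hqP
      obtain rfl : q = p i := by exact_mod_cast hi
      exact absurd (hall i) hne
    · intro h W hW hne _ h4 _
      refine h W hW ?_ (h4 hn5)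
      have hpos := hPS.dProd_pos hW
      obtain ⟨v, hv⟩ := Finset.nonempty_iff_ne_empty.mpr hne
      have := Int.le_of_dvd hpos (Finset.dvd_prod_of_mem (fun v => v) hv)
      have := hPS.five_le (hW hv)
      unfold SelmerTwo.dProd at *
      omega
  · have hn5 : SelmerTwo.dProd P ≡ 5 [ZMOD 8] := by unfold Int.ModEq at *; omega
    rw [hPS.selmer'_eq_iff]
    constructor
    · intro h
      refine ⟨?_, fun W hW h4 => h W hW fun _ => h4⟩
      -- Some prime must be `2 mod 3`, because `n ≡ 2 (mod 3)`.
      have hex : ∃ j, ¬ p j ≡ 1 [MOD 3] := by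
        by_contra! hall
        have : SelmerTwo.dProd P ≡ 1 [ZMOD 3] :=
          SelmerTwo.dProd_modEq_one_of_forall fun v hv => by
            obtain ⟨i, rfl⟩ := hmem' v hv
            exact hgood i (hall i)
        unfold Int.ModEq at *; omega
      obtain ⟨j, hj⟩ := hex
      refine ⟨j, (hmod j).resolve_left hj, fun i hij => ?_⟩
      by_contra hi
      exact hij (SelmerTwo.eq_of_not_modEq hp5 hinj hP h hi hj)
    · rintro ⟨-, h⟩ W hW h4
      exact h W hW (h4 hn5)
  · have hn5 : SelmerTwo.dProd P ≡ 5 [ZMOD 8] := by unfold Int.ModEq at *; omega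
    have hj1 : ¬ p j ≡ 1 [MOD 3] := by unfold Nat.ModEq at *; omega
    have hj2 : p j ≠ 2 := by have := hp5 j; omega
    rw [hPS.selmer_eq_iff]
    have hgoodP : ∀ v ∈ P.erase (p j : ℤ), v ≡ 1 [ZMOD 3] := fun v hv => by
      rw [Finset.mem_erase] at hv
      obtain ⟨i, rfl⟩ := hmem' v hv.2
      exact hgood i (hi i fun h => hv.1 (by rw [h]))
    have hnd : ∀ W ⊆ P, (p j : ℤ) ∉ W → ¬ (p j : ℤ) ∣ SelmerTwo.dProd W := fun W hW h => by
      rwa [(hPS.isVertexSet.mono hW).dvd_dProd_iff (hp j).out]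
    constructor
    · intro h W hW hne hleg
      have hWP := hW.trans (Finset.erase_subset _ _)
      have hjW : (p j : ℤ) ∉ W := fun h => by simpa using hW h
      refine h W hWP hne (SelmerTwo.dProd_modEq_one_of_forall fun v hv => hgoodP v (hW hv))
        (fun h => absurd hn5 h) ?_
      intro q hq hqP hq1
      obtain ⟨i, hqi⟩ := hmem' _ hqP
      obtain rfl : q = p i := by exact_mod_cast hqi
      obtain rfl : i = j := by
        by_contra hij
        exact hq1 (hi i hij)
      exact (SelmerTwo.isSquare_intCast_iff hj2 (hnd W hWP hjW)).mpr hleg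
    · intro h W hW hne _ _ hloc
      have hsq := hloc (p j) (hmem j) hj1
      -- If `p j ∈ W`, then `d(W)` has valuation 1 at `p j` and cannot be a local square. So `W`
      -- avoids `p j`, and the local condition becomes a Legendre symbol.
      have hjW : (p j : ℤ) ∉ W := fun hmemW =>
        SelmerTwo.not_isSquare_of_norm_eq_inv (SelmerTwo.norm_intCast_of_dvd
          (((hPS.isVertexSet.mono hW).dvd_dProd_iff (hp j).out).mpr hmemW)
          ((hPS.isVertexSet.mono hW).sq_not_dvd (hp j).out)) hsq
      refine h W (fun v hv => Finset.mem_erase.mpr ⟨?_, hW hv⟩) hne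
        ((SelmerTwo.isSquare_intCast_iff hj2 (hnd W hW hjW)).mp hsq)
      rintro rfl
      exact hjW hv
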